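/- Setting. Let $\Omega$ be a finite non-empty set of states, $\Delta(\Omega)$ the simplex of probability vectors on $\Omega$ (with its Euclidean topology and Borel $\sigma$-algebra), $p\in\Delta(\Omega)$ a prior, $A$ a measurable space of actions, and $u_S,u_M,u_R:\Omega\times A\to\mathbb R$ bounded measurable utilities of a sender, a mediator and a receiver. The sender chooses a measurable space $S_S$ and a Markov kernel $f_S$ from $\Omega$ to $S_S$; knowing this choice, the mediator chooses a measurable space $S_M$ and a Markov kernel $f_M$ from $S_S$ to $S_M$; knowing both choices, the receiver chooses a Markov kernel $f_R$ from $S_M$ to $A$. Then $\omega\sim p$, $s_S\sim f_S(\omega)$, $s_M\sim f_M(s_S)$ and $a\sim f_R(s_M)$ are drawn, and the agents get the expected values of $u_S(\omega,a)$, $u_M(\omega,a)$, $u_R(\omega,a)$. A strategy prescribes a policy after every history of policies chosen by the predecessors. For $\varepsilon\ge 0$ a policy is an $\varepsilon$-best reply to a history if no other policy raises the agent's payoff by more than $\varepsilon$, given that the successors follow their strategies. Fix a Markov kernel $r$ from $\Delta(\Omega)$ to $A$ describing belief-driven behavior of the receiver: after every history, on observing a signal $s_M$, she draws the action from $r(q)$,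 where $q$ is the conditional distribution of $\omega$ given $s_M$. A subgame perfect $\varepsilon$-equilibrium with refined tie-breaking ($\varepsilon$-RTSPE) is a strategy profile in which the receiver behaves according to $r$, every agent's policy is an $\varepsilon$-best reply at every history, and the mediator passes the observed signal on unchanged at every history where doing so is an $\varepsilon$-best reply. Let $V_S^\varepsilon(p)$ be the supremum of the sender's payoff over all $\varepsilon$-RTSPE ($-\infty$ if there are none). The indirect utilities are the functions on $\Delta(\Omega)$ $$v_S(q)=\int_A\sum_{k\in\Omega}q_k\,u_S(k,a)\,r(q)(\mathrm da),\qquad v_M(q)=\int_A\sum_{k\in\Omega}q_k\,u_M(k,a)\,r(q)(\mathrm da).$$ For $\nu,\mu\in\Delta(\Delta(\Omega))$ write $\nu\preceq\mu$ if there are random beliefs $q_1\sim\nu$, $q_2\sim\mu$ on one probability space with $\mathbb E[q_2\mid q_1]=q_1$. Let $$\mathcal M^\varepsilon=\{\mu\in\Delta(\Delta(\Omega)) : \mathbb E_\mu[v_M]\ge\mathbb E_\nu[v_M]-\varepsilon\ \text{ for all }\nu\preceq\mu\},$$ $$\mathrm{cav}_{\mathcal M}[v_S](p)=\sup\{\mathbb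 E_\mu[v_S(q)] : \mu\in\mathcal M,\ \mathbb E_\mu[q]=p\}.$$ Let $D$ be the set of families $(q_k)_{k\in\Omega}$ in $\Delta(\Omega)$ that are affine dominating with respect to $v_M$, i.e. $\sum_k\alpha_k v_M(q_k)\ge v_M\big(\sum_k\alpha_k q_k\big)$ for all $\alpha\in\Delta(\Omega)$, and let $$\mathrm{cav}_D[v_S](p)=\max\Big\{\sum_{k\in\Omega}\alpha_k v_S(q_k) : (q_k)\in D,\ \alpha\in\Delta(\Omega),\ \sum_{k\in\Omega}\alpha_kq_k=p\Big\}.$$ Theorem. (1) For every $\varepsilon>0$, if the receiver's behavior $r$ is an $\varepsilon$-best reply at every history, then $V_S^\varepsilon(p)=\mathrm{cav}_{\mathcal M^\varepsilon}[v_S](p)$. (2) If the receiver's behavior $r$ is a best reply ($\varepsilon=0$) at every history, $v_S$ is upper semicontinuous and $v_M$ is continuous, then there is a $0$-RTSPE in which the sender's payoff equals $V_S^0(p)$, the maximum defining $\mathrm{cav}_D[v_S](p)$ is attained, and $$V_S^0(p)=\mathrm{cav}_{\mathcal M^0}[v_S](p)=\mathrm{cav}_D[v_S](p).$$ -/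

import Mathlib

open MeasureTheory ProbabilityTheory
open scoped ProbabilityTheory

universe u v

namespace MediatedPersuasion

noncomputable section

/-! ### Beliefs -/

/-- `Δ(Ω)`: probability vectors on the finite set of states `Ω`, with the topology and the Borel
`σ`-algebra inherited from `Ω → ℝ`. -/
abbrev Belief (Ω : Type u) [Fintype Ω] : Type u := stdSimplex ℝ Ω

/-- A belief, regarded as a probability measure on the set of states. -/
def Belief.toMeasure {Ω : Type u} [Fintype Ω] [MeasurableSpace Ω] (p : Belief Ω) : Measure Ω :=
  ∑ k, ENNReal.ofReal (p.1 k) • Measure.dirac k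

instance Belief.isProbabilityMeasure_toMeasure {Ω : Type u} [Fintype Ω] [MeasurableSpace Ω]
    (p : Belief Ω) : IsProbabilityMeasure p.toMeasure := by
  constructor
  simp only [Belief.toMeasure, Measure.coe_finsetSum, Finset.sum_apply, Measure.smul_apply,
    measure_univ, smul_eq_mul, mul_one]
  rw [← ENNReal.ofReal_sum_of_nonneg (fun k _ => p.2.1 k), p.2.2, ENNReal.ofReal_one]

/-- The convex combination `∑ₖ αₖ qₖ` of beliefs. -/
def Belief.mix {Ω : Type u} [Fintype Ω] (α : Belief Ω) (q : Ω → Belief Ω) : Belief Ω :=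
  ⟨∑ k, α.1 k • (q k).1,
    (convex_stdSimplex ℝ Ω).sum_mem (fun k _ => α.2.1 k) α.2.2 (fun k _ => (q k).2)⟩

/-- `posteriorBelief p κ s` is the conditional distribution of the state given the signal `s`, when
the state has law `p` and the signal is drawn from the Markov kernel `κ`. -/
def posteriorBelief {Ω : Type u} [Fintype Ω] [Nonempty Ω] [MeasurableSpace Ω]
    [DiscreteMeasurableSpace Ω] {S : Type u} [MeasurableSpace S] (p : Belief Ω) (κ : Kernel Ω S)
    [IsMarkovKernel κ] (s : S) : Belief Ω :=
  ⟨fun k => ((κ†p.toMeasure) s).real {k}, fun _ => measureReal_nonneg, by simp⟩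

theorem measurable_posteriorBelief {Ω : Type u} [Fintype Ω] [Nonempty Ω] [MeasurableSpace Ω]
    [DiscreteMeasurableSpace Ω] {S : Type u} [MeasurableSpace S] (p : Belief Ω) (κ : Kernel Ω S)
    [IsMarkovKernel κ] : Measurable (posteriorBelief p κ) :=
  Measurable.subtype_mk <| measurable_pi_lambda _ fun k =>
    ((κ†p.toMeasure).measurable_coe (MeasurableSet.singleton k)).ennreal_toReal

/-! ### The game

Agents choose policies in the order sender, mediator, receiver. Every chosen policy is public, so a
strategy prescribes a policy as a function of the policies chosen earlier. -/

/-- A policy of an agent who observes an element of `S`: a measurable space of outgoing signals and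
a Markov kernel into it. Both are chosen by the agent. -/
structure SignalingPolicy (S : Type u) [MeasurableSpace S] where
  Signal : Type u
  [measurableSpace : MeasurableSpace Signal]
  kernel : Kernel S Signal
  [isMarkovKernel : IsMarkovKernel kernel]

attribute [instance] SignalingPolicy.measurableSpace SignalingPolicy.isMarkovKernel

/-- The policy that passes the observed signal on unchanged. -/
def SignalingPolicy.fullRevelation (S : Type u) [MeasurableSpace S] : SignalingPolicy S where
  Signal := S
  kernel := Kernel.id

/-- A policy of a receiver who observes an element of `T`: a randomized action for every signal. -/
structure ReceiverPolicy (T : Type u) [MeasurableSpace T] (A : Type v) [MeasurableSpace A] where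
  kernel : Kernel T A
  [isMarkovKernel : IsMarkovKernel kernel]

attribute [instance] ReceiverPolicy.isMarkovKernel

/-- A profile of strategies of the sender, the mediator and the receiver. -/
structure StrategyProfile (Ω : Type u) [MeasurableSpace Ω] (A : Type v) [MeasurableSpace A] where
  sender : SignalingPolicy Ω
  mediator : (F : SignalingPolicy Ω) → SignalingPolicy F.Signal
  receiver : (F : SignalingPolicy Ω) → (G : SignalingPolicy F.Signal) → ReceiverPolicy G.Signal A

/-- The expected utility `𝔼[u(ω, a)]` under the policies `F`, `G`, `H` of the sender, the mediator
and the receiver. -/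
def expectedUtility {Ω : Type u} [Fintype Ω] [MeasurableSpace Ω] {A : Type v} [MeasurableSpace A]
    (p : Belief Ω) (u : Ω × A → ℝ) (F : SignalingPolicy Ω) (G : SignalingPolicy F.Signal)
    (H : ReceiverPolicy G.Signal A) : ℝ :=
  ∫ x, u x ∂(p.toMeasure ⊗ₘ (H.kernel ∘ₖ (G.kernel ∘ₖ F.kernel)))

/-- The receiver's policy that, at the history `(F, G)`, maps the observed signal to the receiver's
posterior belief and then draws the action from `r`. -/
def beliefDrivenPolicy {Ω : Type u} [Fintype Ω] [Nonempty Ω] [MeasurableSpace Ω]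
    [DiscreteMeasurableSpace Ω] {A : Type v} [MeasurableSpace A] (p : Belief Ω)
    (r : Kernel (Belief Ω) A) [IsMarkovKernel r] (F : SignalingPolicy Ω)
    (G : SignalingPolicy F.Signal) : ReceiverPolicy G.Signal A where
  kernel := r.comap (posteriorBelief p (G.kernel ∘ₖ F.kernel)) (measurable_posteriorBelief p _)

/-- `H` is an `ε`-best reply of a receiver with utility `uR` to the history `(F, G)`. -/
def IsReceiverBestReply {Ω : Type u} [Fintype Ω] [MeasurableSpace Ω] {A : Type v}
    [MeasurableSpace A] (p : Belief Ω) (uR : Ω × A → ℝ) (ε : ℝ) (F : SignalingPolicy Ω)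
    (G : SignalingPolicy F.Signal) (H : ReceiverPolicy G.Signal A) : Prop :=
  ∀ H' : ReceiverPolicy G.Signal A,
    expectedUtility p uR F G H' ≤ expectedUtility p uR F G H + ε

/-- `G` is an `ε`-best reply of a mediator with utility `uM` to the history `F`, when the receiver
follows the strategy of the profile `σ`. -/
def IsMediatorBestReply {Ω : Type u} [Fintype Ω] [MeasurableSpace Ω] {A : Type v}
    [MeasurableSpace A] (p : Belief Ω) (uM : Ω × A → ℝ) (ε : ℝ) (σ : StrategyProfile Ω A)
    (F : SignalingPolicy Ω) (G : SignalingPolicy F.Signal) : Prop :=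
  ∀ G' : SignalingPolicy F.Signal,
    expectedUtility p uM F G' (σ.receiver F G') ≤ expectedUtility p uM F G (σ.receiver F G) + ε

/-- `F` is an `ε`-best reply of a sender with utility `uS`, when the mediator and the receiver
follow the strategies of the profile `σ`. -/
def IsSenderBestReply {Ω : Type u} [Fintype Ω] [MeasurableSpace Ω] {A : Type v}
    [MeasurableSpace A] (p : Belief Ω) (uS : Ω × A → ℝ) (ε : ℝ) (σ : StrategyProfile Ω A)
    (F : SignalingPolicy Ω) : Prop :=
  ∀ F' : SignalingPolicy Ω,
    expectedUtility p uS F' (σ.mediator F') (σ.receiver F' (σ.mediator F')) ≤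
      expectedUtility p uS F (σ.mediator F) (σ.receiver F (σ.mediator F)) + ε

/-- Subgame perfect `ε`-equilibrium with refined tie-breaking in which the receiver's belief-driven
behavior is given by `r`. -/
structure IsRTSPE {Ω : Type u} [Fintype Ω] [Nonempty Ω] [MeasurableSpace Ω]
    [DiscreteMeasurableSpace Ω] {A : Type v} [MeasurableSpace A] (p : Belief Ω)
    (uS uM uR : Ω × A → ℝ) (r : Kernel (Belief Ω) A) [IsMarkovKernel r] (ε : ℝ)
    (σ : StrategyProfile Ω A) : Prop where
  sender_bestReply : IsSenderBestReply p uS ε σ σ.sender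
  mediator_bestReply : ∀ F, IsMediatorBestReply p uM ε σ F (σ.mediator F)
  receiver_bestReply : ∀ F G, IsReceiverBestReply p uR ε F G (σ.receiver F G)
  full_revelation : ∀ F : SignalingPolicy Ω,
    IsMediatorBestReply p uM ε σ F (SignalingPolicy.fullRevelation F.Signal) →
      σ.mediator F = SignalingPolicy.fullRevelation F.Signal
  belief_driven : ∀ F G, σ.receiver F G = beliefDrivenPolicy p r F G

/-- The expected utility of the sender on the path of play of the profile `σ`. -/
def senderPayoff {Ω : Type u} [Fintype Ω] [MeasurableSpace Ω] {A : Type v} [MeasurableSpace A]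
    (p : Belief Ω) (uS : Ω × A → ℝ) (σ : StrategyProfile Ω A) : ℝ :=
  expectedUtility p uS σ.sender (σ.mediator σ.sender) (σ.receiver σ.sender (σ.mediator σ.sender))

/-- The sender's optimal value `V_S^ε(p)`: the supremum of her payoff over equilibria, `-∞` if there
are none. -/
def senderValue {Ω : Type u} [Fintype Ω] [Nonempty Ω] [MeasurableSpace Ω]
    [DiscreteMeasurableSpace Ω] {A : Type v} [MeasurableSpace A] (p : Belief Ω)
    (uS uM uR : Ω × A → ℝ) (r : Kernel (Belief Ω) A) [IsMarkovKernel r] (ε : ℝ) : EReal :=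
  ⨆ (σ : StrategyProfile Ω A) (_ : IsRTSPE p uS uM uR r ε σ), (senderPayoff p uS σ : EReal)

/-- The indirect utility: the expectation of `u` when the state has law `q` and the action is drawn
from `r q`. -/
def indirectUtility {Ω : Type u} [Fintype Ω] {A : Type v} [MeasurableSpace A]
    (r : Kernel (Belief Ω) A) (u : Ω × A → ℝ) (q : Belief Ω) : ℝ :=
  ∫ a, ∑ k, q.1 k * u (k, a) ∂(r q)

/-! ### Garblings and constrained concavifications -/

/-- `ν ⪯ μ`: there are random beliefs `q₁ ∼ ν` and `q₂ ∼ μ`, with joint law `γ`, such that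
`𝔼[q₂ ∣ q₁] = q₁`. -/
def IsMeanPreservingContraction {Ω : Type u} [Fintype Ω] (ν μ : ProbabilityMeasure (Belief Ω)) :
    Prop :=
  ∃ γ : Measure (Belief Ω × Belief Ω), γ.map Prod.fst = ν ∧ γ.map Prod.snd = μ ∧
    ∀ k : Ω, γ[fun x => x.2.1 k | MeasurableSpace.comap Prod.fst inferInstance]
      =ᵐ[γ] fun x => x.1.1 k

/-- `𝓜^ε`: the belief distributions that no garbling improves by more than `ε` for an agent with
indirect utility `v`. -/
def nonGarbled {Ω : Type u} [Fintype Ω] (v : Belief Ω → ℝ) (ε : ℝ) :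
    Set (ProbabilityMeasure (Belief Ω)) :=
  {μ | ∀ ν, IsMeanPreservingContraction ν μ → (∫ q, v q ∂ν) - ε ≤ ∫ q, v q ∂μ}

/-- `cav_𝓜[v](p) = sup {𝔼_μ[v(q)] ∣ μ ∈ 𝓜, 𝔼_μ[q] = p}`. -/
def cav {Ω : Type u} [Fintype Ω] (M : Set (ProbabilityMeasure (Belief Ω))) (v : Belief Ω → ℝ)
    (p : Belief Ω) : EReal :=
  ⨆ (μ : ProbabilityMeasure (Belief Ω)) (_ : μ ∈ M ∧ ∀ k, ∫ q : Belief Ω, q.1 k ∂μ = p.1 k),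
    ((∫ q, v q ∂μ : ℝ) : EReal)

/-- The beliefs `(q k)`, indexed by `k ∈ Ω`, are affine dominating with respect to `f`. -/
def AffineDominating {Ω : Type u} [Fintype Ω] (f : Belief Ω → ℝ) (q : Ω → Belief Ω) : Prop :=
  ∀ α : Belief Ω, f (Belief.mix α q) ≤ ∑ k, α.1 k * f (q k)

/-- The values `∑ₖ αₖ v(qₖ)` with `q ∈ D`, `α ∈ Δ(Ω)` and `∑ₖ αₖ qₖ = p`; the maximum of this set
is the constrained concavification `cav_D[v](p)`. -/
def splittingValues {Ω : Type u} [Fintype Ω] (D : Set (Ω → Belief Ω)) (v : Belief Ω → ℝ)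
    (p : Belief Ω) : Set ℝ :=
  {x | ∃ q ∈ D, ∃ α : Belief Ω, Belief.mix α q = p ∧ x = ∑ k, α.1 k * v (q k)}

end

end MediatedPersuasion

/-!
Against a belief-driven receiver all payoffs are expectations of indirect utilities under the law of
the receiver's posterior (`expectedUtility_beliefDrivenPolicy`), so the game is one about
distributions of beliefs. By Bayes' rule the sender can induce exactly the distributions with mean
`p` (`integral_coord_posteriorLaw`, `exists_posteriorLaw_eq`). After a policy `F` the mediator can
induce exactly the mean-preserving contractions of the posterior law of `F`: garbling the signal
contracts the posterior (`isMeanPreservingContraction_posteriorLaw_comp`), and conversely a coupling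
is implemented by drawing the new belief from its conditional law given the old one
(`exists_garbling`). Since garblings compose, what an equilibrium mediator leaves lies in `𝓜^ε`;
since the mediator breaks ties in favor of full revelation, every (almost) optimal element of `𝓜^ε`
is the outcome of an equilibrium (`senderValue_le_cav`, `exists_isRTSPE`). For `ε > 0` the required
`ε`-best replies exist because payoffs are bounded.

For `ε = 0` existence is a matter of compactness. The couplings under a given distribution are weakly
compact, so the mediator has best replies (`exists_optimal_contraction`). For the sender, let
`μ ∈ 𝓜⁰`. Pooling small neighborhoods of support points is not profitable for the mediator, so every
family of beliefs in the support of `μ` is affine dominating (`affineDominating_of_mem_support`). The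
pairs of a belief `x` and a number below the value of a splitting of `x` into `|Ω|` points of the
support form a closed convex set; convexity is the fact that a linear program with `|Ω|` equality
constraints has a basic optimal solution (`exists_mix_eq_of_sum`). Hence the mean of `μ` has a
splitting in the support that is worth at least as much as `μ` to the sender
(`exists_splitting_of_ae_mem`). Conversely a splitting into affine dominating beliefs is in `𝓜⁰`, by
Jensen's inequality applied to the conditional laws of a coupling
(`AffineDominating.splittingLaw_mem_nonGarbled`). So both concavifications agree, and the second is
a maximum of an upper semicontinuous function over a compact set.
-/

namespace MediatedPersuasion

/-! ### Bounded functions and coordinates of beliefs -/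

theorem integrable_of_abs_le {X : Type*} [MeasurableSpace X] {μ : Measure X} [IsFiniteMeasure μ]
    {f : X → ℝ} (hf : Measurable f) {C : ℝ} (hC : ∀ x, |f x| ≤ C) : Integrable f μ :=
  Integrable.of_bound hf.aestronglyMeasurable C (ae_of_all _ hC)

theorem abs_integral_le_of_abs_le {X : Type*} [MeasurableSpace X] {μ : Measure X}
    [IsProbabilityMeasure μ] {f : X → ℝ} {C : ℝ} (hC : ∀ x, |f x| ≤ C) : |∫ x, f x ∂μ| ≤ C := by
  simpa using norm_integral_le_of_norm_le_const (μ := μ) (f := f) (ae_of_all _ hC)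

section Coordinates

variable {Ω : Type u} [Fintype Ω]

theorem Belief.coord_le_one (q : Belief Ω) (k : Ω) : q.1 k ≤ 1 := by
  rw [← q.2.2]
  exact Finset.single_le_sum (fun i _ => q.2.1 i) (Finset.mem_univ k)

theorem Belief.abs_coord_le_one (q : Belief Ω) (k : Ω) : |q.1 k| ≤ 1 := by
  rw [abs_of_nonneg (q.2.1 k)]
  exact q.coord_le_one k

theorem Belief.continuous_coord (k : Ω) : Continuous fun q : Belief Ω => q.1 k :=
  (continuous_apply k).comp continuous_subtype_val

theorem Belief.measurable_coord (k : Ω) : Measurable fun q : Belief Ω => q.1 k :=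
  (Belief.continuous_coord k).measurable

theorem Belief.mix_coord (α : Belief Ω) (q : Ω → Belief Ω) (j : Ω) :
    (Belief.mix α q).1 j = ∑ k, α.1 k * (q k).1 j := by
  simp [Belief.mix]

theorem Belief.abs_sum_mul_le (q : Belief Ω) {g : Ω → ℝ} {C : ℝ} (hg : ∀ k, |g k| ≤ C) :
    |∑ k, q.1 k * g k| ≤ C := by
  calc |∑ k, q.1 k * g k| ≤ ∑ k, |q.1 k * g k| := Finset.abs_sum_le_sum_abs _ _
    _ ≤ ∑ k, q.1 k * C := by
        refine Finset.sum_le_sum fun k _ => ?_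
        rw [abs_mul, abs_of_nonneg (q.2.1 k)]
        exact mul_le_mul_of_nonneg_left (hg k) (q.2.1 k)
    _ = C := by rw [← Finset.sum_mul, q.2.2, one_mul]

theorem Belief.integral_toMeasure [MeasurableSpace Ω] [DiscreteMeasurableSpace Ω] (p : Belief Ω)
    (g : Ω → ℝ) : ∫ ω, g ω ∂p.toMeasure = ∑ k, p.1 k * g k := by
  unfold Belief.toMeasure
  rw [integral_finsetSum_measure]
  · simp [integral_smul_measure, ENNReal.toReal_ofReal (p.2.1 _)]
  · intro k _
    exact (integrable_dirac (by simp)).smul_measure ENNReal.ofReal_ne_top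

theorem Belief.toMeasure_singleton [MeasurableSpace Ω] [DiscreteMeasurableSpace Ω] (p : Belief Ω)
    (k : Ω) : p.toMeasure {k} = ENNReal.ofReal (p.1 k) := by
  classical
  simp [Belief.toMeasure, Set.indicator_apply, Finset.sum_ite_eq']

end Coordinates

/-! ### Posterior beliefs and their distribution -/

section Posterior

variable {Ω : Type u} [Fintype Ω] [Nonempty Ω] [MeasurableSpace Ω] [DiscreteMeasurableSpace Ω]
  {S : Type u} [MeasurableSpace S]

/-- Bayes' rule: the posterior probability of `k` is the density of the joint law of the event
`ω = k` and the signal with respect to the law of the signal. -/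
theorem withDensity_posteriorBelief (p : Belief Ω) (κ : Kernel Ω S) [IsMarkovKernel κ] (k : Ω) :
    (κ ∘ₘ p.toMeasure).withDensity (fun s => ENNReal.ofReal ((posteriorBelief p κ s).1 k)) =
      ENNReal.ofReal (p.1 k) • κ k := by
  ext B hB
  have h := congrArg (fun m : Measure (S × Ω) => m (B ×ˢ {k}))
    (compProd_posterior_eq_map_swap (κ := κ) (μ := p.toMeasure))
  beta_reduce at h
  rw [Measure.compProd_apply_prod hB (measurableSet_singleton k),
    Measure.map_apply measurable_swap (hB.prod (measurableSet_singleton k)),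
    Set.preimage_swap_prod, Measure.compProd_apply_prod (measurableSet_singleton k) hB,
    lintegral_singleton, Belief.toMeasure_singleton] at h
  rw [withDensity_apply _ hB, Measure.smul_apply, smul_eq_mul, mul_comm, ← h]
  refine lintegral_congr fun s => ?_
  simp only [posteriorBelief]
  rw [ofReal_measureReal]

theorem integral_posteriorBelief_mul (p : Belief Ω) (κ : Kernel Ω S) [IsMarkovKernel κ] (k : Ω)
    (h : S → ℝ) :
    ∫ s, (posteriorBelief p κ s).1 k * h s ∂(κ ∘ₘ p.toMeasure) = p.1 k * ∫ s, h s ∂(κ k) := by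
  have hm : Measurable fun s => ENNReal.ofReal ((posteriorBelief p κ s).1 k) :=
    ((Belief.measurable_coord k).comp (measurable_posteriorBelief p κ)).ennreal_ofReal
  have := integral_withDensity_eq_integral_toReal_smul (μ := κ ∘ₘ p.toMeasure) hm
    (ae_of_all _ fun _ => ENNReal.ofReal_lt_top) h
  rw [withDensity_posteriorBelief, integral_smul_measure, ENNReal.toReal_ofReal (p.2.1 k)] at this
  simp only [smul_eq_mul] at this
  rw [this]
  exact integral_congr_ae (ae_of_all _ fun s => by
    simp only [ENNReal.toReal_ofReal ((posteriorBelief p κ s).2.1 k)])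

/-- The law of the posterior belief induced by the signaling kernel `κ`. -/
noncomputable def posteriorLaw (p : Belief Ω) (κ : Kernel Ω S) [IsMarkovKernel κ] :
    ProbabilityMeasure (Belief Ω) :=
  ⟨(κ ∘ₘ p.toMeasure).map (posteriorBelief p κ),
    Measure.isProbabilityMeasure_map (measurable_posteriorBelief p κ).aemeasurable⟩

theorem coe_posteriorLaw (p : Belief Ω) (κ : Kernel Ω S) [IsMarkovKernel κ] :
    (posteriorLaw p κ : Measure (Belief Ω)) = (κ ∘ₘ p.toMeasure).map (posteriorBelief p κ) := rfl

theorem integral_posteriorLaw (p : Belief Ω) (κ : Kernel Ω S) [IsMarkovKernel κ]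
    {f : Belief Ω → ℝ} (hf : Measurable f) :
    ∫ q, f q ∂(posteriorLaw p κ) = ∫ s, f (posteriorBelief p κ s) ∂(κ ∘ₘ p.toMeasure) := by
  rw [coe_posteriorLaw,
    integral_map (measurable_posteriorBelief p κ).aemeasurable hf.aestronglyMeasurable]

theorem integral_coord_posteriorLaw (p : Belief Ω) (κ : Kernel Ω S) [IsMarkovKernel κ] (k : Ω) :
    ∫ q : Belief Ω, q.1 k ∂(posteriorLaw p κ) = p.1 k := by
  rw [integral_posteriorLaw p κ (Belief.measurable_coord k)]
  simpa using integral_posteriorBelief_mul p κ k (fun _ => 1)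

/-- If the signal is itself a belief that, for each state, satisfies Bayes' rule as the posterior
given itself would, then it is the posterior almost surely, and its law is the law of the posterior.
-/
theorem posteriorLaw_eq_of_forall_integral (p : Belief Ω) (κ : Kernel Ω (Belief Ω))
    [IsMarkovKernel κ] (ν : ProbabilityMeasure (Belief Ω))
    (h : ∀ k, ∀ f : Belief Ω → ℝ, Measurable f → (∀ x, |f x| ≤ 1) →
      ∫ q, f q * q.1 k ∂ν = p.1 k * ∫ q, f q ∂(κ k)) :
    posteriorLaw p κ = ν := by
  classical
  have hbd : ∀ {B : Set (Belief Ω)} (x : Belief Ω), |B.indicator (fun _ => (1 : ℝ)) x| ≤ 1 := by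
    intro B x
    by_cases hx : x ∈ B <;> simp [hx]
  have hsig : ∀ f : Belief Ω → ℝ, Measurable f → (∀ x, |f x| ≤ 1) →
      ∫ q, f q ∂(κ ∘ₘ p.toMeasure) = ∑ k, p.1 k * ∫ q, f q ∂(κ k) := by
    intro f hf hb
    simp_rw [← integral_posteriorBelief_mul p κ]
    rw [← integral_finsetSum]
    · refine integral_congr_ae (ae_of_all _ fun s => ?_)
      simp only [← Finset.sum_mul, (posteriorBelief p κ s).2.2, one_mul]
    · intro k _
      refine integrable_of_abs_le (C := 1) (((Belief.measurable_coord k).comp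
        (measurable_posteriorBelief p κ)).mul hf) fun x => ?_
      rw [abs_mul]
      exact mul_le_one₀ (Belief.abs_coord_le_one _ _) (abs_nonneg _) (hb x)
  have hlaw : κ ∘ₘ p.toMeasure = (ν : Measure (Belief Ω)) := by
    refine Measure.ext fun B hB => ?_
    rw [← measureReal_eq_measureReal_iff, ← integral_indicator_one hB, ← integral_indicator_one hB]
    change ∫ q, B.indicator (fun _ => (1 : ℝ)) q ∂_ = ∫ q, B.indicator (fun _ => (1 : ℝ)) q ∂_
    have hm : Measurable (B.indicator fun _ => (1 : ℝ)) := measurable_const.indicator hB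
    rw [hsig _ hm hbd]
    simp_rw [← h _ _ hm hbd]
    rw [← integral_finsetSum]
    · refine integral_congr_ae (ae_of_all _ fun q => ?_)
      simp only [← Finset.mul_sum, q.2.2, mul_one]
    · intro k _
      refine integrable_of_abs_le (C := 1) (hm.mul (Belief.measurable_coord k)) fun x => ?_
      rw [abs_mul]
      exact mul_le_one₀ (hbd x) (abs_nonneg _) (Belief.abs_coord_le_one _ _)
  have hae : ∀ k, (fun q => (posteriorBelief p κ q).1 k) =ᵐ[(ν : Measure (Belief Ω))]
      fun q => q.1 k := by
    intro k
    refine Integrable.ae_eq_of_forall_setIntegral_eq _ _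
      (integrable_of_abs_le ((Belief.measurable_coord k).comp (measurable_posteriorBelief p κ))
        fun x => Belief.abs_coord_le_one _ _)
      (integrable_of_abs_le (Belief.measurable_coord k) fun x => Belief.abs_coord_le_one _ _) ?_
    intro B hB _
    have h1 := integral_posteriorBelief_mul p κ k (B.indicator fun _ => (1 : ℝ))
    rw [← h k _ (measurable_const.indicator hB) hbd, hlaw] at h1
    rw [← integral_indicator hB, ← integral_indicator hB]
    convert h1 using 2 <;>
    · ext q
      by_cases hq : q ∈ B <;> simp [hq]
  apply Subtype.ext
  change (posteriorLaw p κ : Measure (Belief Ω)) = ν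
  rw [coe_posteriorLaw, hlaw]
  have : posteriorBelief p κ =ᵐ[(ν : Measure (Belief Ω))] id := by
    filter_upwards [ae_all_iff.2 hae] with q hq
    exact Subtype.ext (funext hq)
  rw [Measure.map_congr this, Measure.map_id]

end Posterior

/-! ### Garblings as couplings -/

section Coupling

variable {Ω : Type u} [Fintype Ω]

theorem integrable_mul_coord {X : Type*} [MeasurableSpace X] {μ : Measure X} [IsFiniteMeasure μ]
    {g : X → ℝ} {b : X → Belief Ω} (hg : Measurable g) (hb : Measurable b) {C : ℝ}
    (hC : ∀ x, |g x| ≤ C) (k : Ω) : Integrable (fun x => g x * (b x).1 k) μ := by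
  refine integrable_of_abs_le (C := C) (hg.mul ((Belief.measurable_coord k).comp hb)) fun x => ?_
  rw [abs_mul]
  exact (mul_le_of_le_one_right (abs_nonneg _) (Belief.abs_coord_le_one _ _)).trans (hC x)

/-- A coupling witnessing `ν ⪯ μ`, with the conditional expectation tested against bounded
measurable functions of the first coordinate. -/
theorem IsMeanPreservingContraction.exists_coupling {ν μ : ProbabilityMeasure (Belief Ω)}
    (h : IsMeanPreservingContraction ν μ) :
    ∃ γ : Measure (Belief Ω × Belief Ω), IsProbabilityMeasure γ ∧ γ.map Prod.fst = ν ∧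
      γ.map Prod.snd = μ ∧ ∀ (k : Ω) (f : Belief Ω → ℝ) (C : ℝ), Measurable f →
        (∀ x, |f x| ≤ C) → ∫ x, f x.1 * x.2.1 k ∂γ = ∫ x, f x.1 * x.1.1 k ∂γ := by
  obtain ⟨γ, h1, h2, h3⟩ := h
  have hprob : IsProbabilityMeasure γ := by
    constructor
    rw [← Set.preimage_univ (f := Prod.fst), ← Measure.map_apply measurable_fst MeasurableSet.univ,
      h1, measure_univ]
  refine ⟨γ, hprob, h1, h2, fun k f C hf hC => ?_⟩
  have hm : MeasurableSpace.comap (Prod.fst : Belief Ω × Belief Ω → Belief Ω) inferInstance ≤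
      (inferInstance : MeasurableSpace (Belief Ω × Belief Ω)) := measurable_fst.comap_le
  have hfm : StronglyMeasurable[MeasurableSpace.comap
      (Prod.fst : Belief Ω × Belief Ω → Belief Ω) inferInstance]
      (fun x : Belief Ω × Belief Ω => f x.1) :=
    (hf.comp (comap_measurable _)).stronglyMeasurable
  have hI := integrable_mul_coord (μ := γ) (hf.comp measurable_fst) measurable_snd
    (fun x => hC x.1) k
  have hI' : Integrable (fun x : Belief Ω × Belief Ω => x.2.1 k) γ :=
    integrable_of_abs_le ((Belief.measurable_coord k).comp measurable_snd)
      fun x => Belief.abs_coord_le_one _ _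
  have hpull := condExp_mul_of_stronglyMeasurable_left (μ := γ) hfm hI hI'
  rw [← integral_condExp hm]
  refine integral_congr_ae ?_
  filter_upwards [hpull, h3 k] with x hx hx'
  refine hx.trans ?_
  simp only [Pi.mul_apply, hx']

/-- To prove `ν ⪯ μ` it suffices to test the conditional expectation under a coupling against
bounded continuous functions. -/
theorem isMeanPreservingContraction_of_coupling {ν μ : ProbabilityMeasure (Belief Ω)}
    (γ : Measure (Belief Ω × Belief Ω)) [IsProbabilityMeasure γ] (h1 : γ.map Prod.fst = ν)
    (h2 : γ.map Prod.snd = μ)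
    (h : ∀ (k : Ω) (f : BoundedContinuousFunction (Belief Ω) ℝ),
      ∫ x, f x.1 * x.2.1 k ∂γ = ∫ x, f x.1 * x.1.1 k ∂γ) :
    IsMeanPreservingContraction ν μ := by
  refine ⟨γ, h1, h2, fun k => ?_⟩
  have hm : MeasurableSpace.comap (Prod.fst : Belief Ω × Belief Ω → Belief Ω) inferInstance ≤
      (inferInstance : MeasurableSpace (Belief Ω × Belief Ω)) := measurable_fst.comap_le
  -- Integrals against the law of the first coordinate under `γ` weighted by `b k`. The defining
  -- property of the conditional expectation is that this law is the same for both coordinates `b`.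
  have key : ∀ b : Belief Ω × Belief Ω → Belief Ω, Measurable b → ∀ f : Belief Ω → ℝ,
      Measurable f →
      ∫ y, f y ∂((γ.withDensity fun x => ENNReal.ofReal ((b x).1 k)).map Prod.fst) =
        ∫ x, f x.1 * (b x).1 k ∂γ := by
    intro b hb f hf
    rw [integral_map measurable_fst.aemeasurable hf.aestronglyMeasurable,
      integral_withDensity_eq_integral_toReal_smul (f := fun x => ENNReal.ofReal ((b x).1 k))
        ((Belief.measurable_coord k).comp hb).ennreal_ofReal
        (ae_of_all _ fun _ => ENNReal.ofReal_lt_top)]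
    refine integral_congr_ae (ae_of_all _ fun x => ?_)
    simp only [ENNReal.toReal_ofReal ((b x).2.1 k), smul_eq_mul, mul_comm]
  have hfin : ∀ b : Belief Ω × Belief Ω → Belief Ω,
      IsFiniteMeasure (γ.withDensity fun x => ENNReal.ofReal ((b x).1 k)) := by
    intro b
    refine isFiniteMeasure_withDensity (ne_top_of_le_ne_top (measure_ne_top γ Set.univ) ?_)
    rw [← lintegral_one]
    exact lintegral_mono fun x => by simpa using (b x).coord_le_one k
  have := hfin Prod.fst
  have := hfin Prod.snd
  have heq : (γ.withDensity fun x => ENNReal.ofReal (x.2.1 k)).map Prod.fst =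
      (γ.withDensity fun x => ENNReal.ofReal (x.1.1 k)).map Prod.fst := by
    refine ext_of_forall_integral_eq_of_IsFiniteMeasure fun f => ?_
    rw [key _ measurable_snd f f.continuous.measurable,
      key _ measurable_fst f f.continuous.measurable, h k f]
  have hI : ∀ b : Belief Ω × Belief Ω → Belief Ω, Measurable b →
      Integrable (fun x => (b x).1 k) γ := fun b hb =>
    integrable_of_abs_le ((Belief.measurable_coord k).comp hb)
      fun x => Belief.abs_coord_le_one _ _
  symm
  refine ae_eq_condExp_of_forall_setIntegral_eq hm (hI _ measurable_snd)
    (fun s _ _ => (hI _ measurable_fst).integrableOn) ?_ ?_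
  · rintro s ⟨B, hB, rfl⟩ -
    have hs : MeasurableSet (Prod.fst ⁻¹' B : Set (Belief Ω × Belief Ω)) := measurable_fst hB
    have h3 := key _ measurable_snd _ (measurable_const.indicator hB : Measurable
      (B.indicator fun _ => (1 : ℝ)))
    have h4 := key _ measurable_fst _ (measurable_const.indicator hB : Measurable
      (B.indicator fun _ => (1 : ℝ)))
    rw [heq, h4] at h3
    rw [← integral_indicator hs, ← integral_indicator hs]
    convert h3 using 2 <;>
    · ext x
      by_cases hx : x.1 ∈ B <;> simp [hx]
  · exact (((Belief.measurable_coord k).comp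
      (comap_measurable _)).stronglyMeasurable).aestronglyMeasurable

end Coupling

/-! ### Signaling policies and belief distributions -/

section Correspondence

variable {Ω : Type u} [Fintype Ω] [Nonempty Ω] [MeasurableSpace Ω] [DiscreteMeasurableSpace Ω]
  {S : Type u} [MeasurableSpace S]

/-- Splitting: every distribution of beliefs with mean `p` is the law of the posterior of some
signaling kernel. -/
theorem exists_posteriorLaw_eq (p : Belief Ω) (μ : ProbabilityMeasure (Belief Ω))
    (hμ : ∀ k, ∫ q : Belief Ω, q.1 k ∂μ = p.1 k) :
    ∃ F : SignalingPolicy Ω, posteriorLaw p F.kernel = μ := by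
  classical
  -- Bayes' rule dictates the kernel; a state of prior probability zero may send any signal.
  let m : Ω → Measure (Belief Ω) := fun k =>
    if p.1 k = 0 then μ
    else (μ : Measure (Belief Ω)).withDensity fun q => ENNReal.ofReal (q.1 k / p.1 k)
  have hmeas : ∀ k, Measurable fun q : Belief Ω => q.1 k / p.1 k := fun k =>
    (Belief.measurable_coord k).div_const _
  have hm : ∀ k, IsProbabilityMeasure (m k) := by
    intro k
    by_cases hk : p.1 k = 0
    · simp only [m, hk, if_true]
      infer_instance
    · simp only [m, hk, if_false]
      refine ⟨?_⟩
      rw [withDensity_apply _ MeasurableSet.univ, Measure.restrict_univ, ← ofReal_integral_eq_lintegral_ofReal, integral_div, hμ k, div_self hk, ENNReal.ofReal_one]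
      · exact (integrable_of_abs_le (Belief.measurable_coord k)
          fun q => Belief.abs_coord_le_one q k).div_const _
      · exact ae_of_all _ fun q => div_nonneg (q.2.1 k) (p.2.1 k)
  let κ : Kernel Ω (Belief Ω) := ⟨m, Measurable.of_discrete⟩
  have hκ : IsMarkovKernel κ := ⟨hm⟩
  refine ⟨⟨Belief Ω, κ⟩, posteriorLaw_eq_of_forall_integral p κ μ fun k f hf hb => ?_⟩
  change _ = p.1 k * ∫ q, f q ∂(m k)
  by_cases hk : p.1 k = 0
  · have h0 : (fun q : Belief Ω => q.1 k) =ᵐ[(μ : Measure (Belief Ω))] 0 := by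
      refine (integral_eq_zero_iff_of_nonneg (fun q => q.2.1 k)
        (integrable_of_abs_le (Belief.measurable_coord k)
          fun q => Belief.abs_coord_le_one q k)).1 ?_
      rw [hμ k, hk]
    rw [hk, zero_mul]
    refine integral_eq_zero_of_ae ?_
    filter_upwards [h0] with q hq
    simp [show q.1 k = 0 from hq]
  · simp only [m, hk, if_false]
    rw [integral_withDensity_eq_integral_toReal_smul (hmeas k).ennreal_ofReal
      (ae_of_all _ fun _ => ENNReal.ofReal_lt_top), ← integral_const_mul]
    refine integral_congr_ae (ae_of_all _ fun q => ?_)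
    simp only [ENNReal.toReal_ofReal (div_nonneg (q.2.1 k) (p.2.1 k)), smul_eq_mul]
    field_simp

theorem integral_posteriorBelief_mul_kernel {T : Type*} [MeasurableSpace T] (p : Belief Ω)
    (F : Kernel Ω S) [IsMarkovKernel F] (G : Kernel S T) [IsMarkovKernel G] (k : Ω)
    {h : T → ℝ} (hh : Measurable h) {C : ℝ} (hC : ∀ t, |h t| ≤ C) :
    ∫ s, (posteriorBelief p F s).1 k * ∫ t, h t ∂(G s) ∂(F ∘ₘ p.toMeasure) =
      p.1 k * ∫ t, h t ∂((G ∘ₖ F) k) := by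
  rw [integral_posteriorBelief_mul, Kernel.integral_comp (integrable_of_abs_le hh hC)]

/-- The posterior after a garbled signal is a mean-preserving contraction of the posterior after
the original signal. -/
theorem isMeanPreservingContraction_posteriorLaw_comp {T : Type u} [MeasurableSpace T]
    (p : Belief Ω) (F : Kernel Ω S) [IsMarkovKernel F] (G : Kernel S T) [IsMarkovKernel G] :
    IsMeanPreservingContraction (posteriorLaw p (G ∘ₖ F)) (posteriorLaw p F) := by
  have hF := measurable_posteriorBelief p F
  have hGF := measurable_posteriorBelief p (G ∘ₖ F)
  have hφ : Measurable fun x : S × T => (posteriorBelief p (G ∘ₖ F) x.2, posteriorBelief p F x.1) :=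
    (hGF.comp measurable_snd).prodMk (hF.comp measurable_fst)
  have hsnd : ((F ∘ₘ p.toMeasure) ⊗ₘ G).map Prod.snd = (G ∘ₖ F) ∘ₘ p.toMeasure := by
    rw [← Measure.comp_assoc, ← Measure.snd_compProd (F ∘ₘ p.toMeasure) G, Measure.snd]
  have hfst : ((F ∘ₘ p.toMeasure) ⊗ₘ G).map Prod.fst = F ∘ₘ p.toMeasure := by
    rw [← Measure.fst, Measure.fst_compProd]
  have := Measure.isProbabilityMeasure_map (μ := (F ∘ₘ p.toMeasure) ⊗ₘ G) hφ.aemeasurable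
  refine isMeanPreservingContraction_of_coupling
    (((F ∘ₘ p.toMeasure) ⊗ₘ G).map fun x =>
      (posteriorBelief p (G ∘ₖ F) x.2, posteriorBelief p F x.1)) ?_ ?_ ?_
  · rw [Measure.map_map measurable_fst hφ, coe_posteriorLaw, ← hsnd,
      Measure.map_map hGF measurable_snd]
    rfl
  · rw [Measure.map_map measurable_snd hφ, coe_posteriorLaw]
    exact (Measure.map_map hF measurable_fst).symm.trans (by rw [hfst])
  · intro k f
    have hf := f.continuous.measurable
    have hfb : ∀ q, |f q| ≤ ‖f‖ := fun q => f.norm_coe_le_norm q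
    have hint : Integrable (fun x : S × T => f (posteriorBelief p (G ∘ₖ F) x.2) *
        (posteriorBelief p F x.1).1 k) ((F ∘ₘ p.toMeasure) ⊗ₘ G) :=
      integrable_mul_coord (hf.comp (hGF.comp measurable_snd)) (hF.comp measurable_fst)
        (fun x => hfb _) k
    have hm : ∀ {b : Belief Ω × Belief Ω → Belief Ω}, Measurable b →
        Measurable fun x : Belief Ω × Belief Ω => f x.1 * (b x).1 k := fun hb =>
      (hf.comp measurable_fst).mul ((Belief.measurable_coord k).comp hb)
    rw [integral_map hφ.aemeasurable (hm measurable_snd).aestronglyMeasurable,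
      integral_map hφ.aemeasurable (hm measurable_fst).aestronglyMeasurable]
    calc ∫ x, f (posteriorBelief p (G ∘ₖ F) x.2) * (posteriorBelief p F x.1).1 k
          ∂((F ∘ₘ p.toMeasure) ⊗ₘ G)
        = ∫ s, (posteriorBelief p F s).1 k * ∫ t, f (posteriorBelief p (G ∘ₖ F) t) ∂(G s)
            ∂(F ∘ₘ p.toMeasure) := by
          rw [Measure.integral_compProd hint]
          refine integral_congr_ae (ae_of_all _ fun s => ?_)
          simp only
          rw [integral_mul_const, mul_comm]
      _ = p.1 k * ∫ t, f (posteriorBelief p (G ∘ₖ F) t) ∂((G ∘ₖ F) k) :=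
          integral_posteriorBelief_mul_kernel p F G k (hf.comp hGF) fun t => hfb _
      _ = ∫ t, f (posteriorBelief p (G ∘ₖ F) t) * (posteriorBelief p (G ∘ₖ F) t).1 k
            ∂((G ∘ₖ F) ∘ₘ p.toMeasure) := by
          rw [← integral_posteriorBelief_mul]
          simp only [mul_comm]
      _ = _ := by
          rw [← hsnd, integral_map measurable_snd.aemeasurable]
          exact ((hf.comp hGF).mul ((Belief.measurable_coord k).comp hGF)).aestronglyMeasurable

/-- Every mean-preserving contraction of the posterior induced by `F` can be implemented by a
garbling of the signal: reveal a belief drawn from the conditional law of the coupling given the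
posterior. -/
theorem exists_garbling (p : Belief Ω) (F : Kernel Ω S) [IsMarkovKernel F]
    {ν : ProbabilityMeasure (Belief Ω)} (h : IsMeanPreservingContraction ν (posteriorLaw p F)) :
    ∃ G : SignalingPolicy S, posteriorLaw p (G.kernel ∘ₖ F) = ν := by
  obtain ⟨γ, hγ, h1, h2, h3⟩ := h.exists_coupling
  have hF := measurable_posteriorBelief p F
  have hsw : (γ.map Prod.swap).fst = posteriorLaw p F := by
    rw [Measure.fst, Measure.map_map measurable_fst measurable_swap, ← h2]
    rfl
  have := Measure.isProbabilityMeasure_map (μ := γ) (measurable_swap.aemeasurable)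
  let K := (γ.map Prod.swap).condKernel
  have hdis : (posteriorLaw p F : Measure (Belief Ω)) ⊗ₘ K = γ.map Prod.swap := by
    rw [← hsw]
    exact Measure.disintegrate _ _
  refine ⟨⟨Belief Ω, K.comap _ hF⟩, posteriorLaw_eq_of_forall_integral p _ ν fun k f hf hb => ?_⟩
  change _ = p.1 k * ∫ q, f q ∂((K.comap _ hF ∘ₖ F) k)
  have hsm : StronglyMeasurable fun q => ∫ y, f y ∂(K q) :=
    hf.stronglyMeasurable.integral_kernel
  calc ∫ q, f q * q.1 k ∂ν = ∫ x, f x.1 * x.1.1 k ∂γ := by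
        rw [← h1, integral_map measurable_fst.aemeasurable]
        exact (hf.mul (Belief.measurable_coord k)).aestronglyMeasurable
    _ = ∫ x, f x.1 * x.2.1 k ∂γ := (h3 k f 1 hf hb).symm
    _ = ∫ x, f x.2 * x.1.1 k ∂(γ.map Prod.swap) := by
        rw [integral_map measurable_swap.aemeasurable]
        · rfl
        · exact ((hf.comp measurable_snd).mul
            ((Belief.measurable_coord k).comp measurable_fst)).aestronglyMeasurable
    _ = ∫ q, q.1 k * ∫ y, f y ∂(K q) ∂(posteriorLaw p F) := by
        rw [← hdis, Measure.integral_compProd (f := fun x : Belief Ω × Belief Ω => f x.2 * x.1.1 k)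
          (integrable_mul_coord (hf.comp measurable_snd) measurable_fst (fun x => hb x.2) k)]
        refine integral_congr_ae (ae_of_all _ fun s => ?_)
        simp only
        rw [integral_mul_const, mul_comm]
    _ = p.1 k * ∫ q, f q ∂((K.comap _ hF ∘ₖ F) k) := by
        rw [integral_posteriorLaw p F (f := fun q => q.1 k * ∫ y, f y ∂(K q))
            ((Belief.measurable_coord k).mul hsm.measurable),
          ← integral_posteriorBelief_mul_kernel p F (K.comap _ hF) k hf hb]
        rfl

end Correspondence

/-! ### Payoffs against a belief-driven receiver -/

section Payoff

variable {Ω : Type u} [Fintype Ω] {A : Type v} [MeasurableSpace A]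

theorem measurable_indirectUtility [MeasurableSpace Ω] (r : Kernel (Belief Ω) A)
    [IsMarkovKernel r] {u : Ω × A → ℝ} (hu : Measurable u) :
    Measurable (indirectUtility r u) := by
  have h : StronglyMeasurable (Function.uncurry fun (q : Belief Ω) (a : A) =>
      ∑ k, q.1 k * u (k, a)) := by
    refine Measurable.stronglyMeasurable (Finset.measurable_fun_sum _ fun k _ => ?_)
    exact ((Belief.measurable_coord k).comp measurable_fst).mul
      (hu.comp (measurable_const.prodMk measurable_snd))
  exact h.integral_kernel_prod_right.measurable

theorem abs_indirectUtility_le (r : Kernel (Belief Ω) A) [IsMarkovKernel r] {u : Ω × A → ℝ}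
    {C : ℝ} (hC : ∀ x, |u x| ≤ C) (q : Belief Ω) : |indirectUtility r u q| ≤ C :=
  abs_integral_le_of_abs_le fun a => q.abs_sum_mul_le fun k => hC (k, a)

/-- Against a belief-driven receiver, the payoff of an agent is the expectation of the indirect
utility under the law of the receiver's posterior. -/
theorem expectedUtility_beliefDrivenPolicy [Nonempty Ω] [MeasurableSpace Ω]
    [DiscreteMeasurableSpace Ω] (p : Belief Ω) (r : Kernel (Belief Ω) A) [IsMarkovKernel r]
    {u : Ω × A → ℝ} (hu : Measurable u) (hu_bdd : ∃ C, ∀ x, |u x| ≤ C) (F : SignalingPolicy Ω)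
    (G : SignalingPolicy F.Signal) :
    expectedUtility p u F G (beliefDrivenPolicy p r F G) =
      ∫ q, indirectUtility r u q ∂(posteriorLaw p (G.kernel ∘ₖ F.kernel)) := by
  obtain ⟨C, hC⟩ := hu_bdd
  set κ := G.kernel ∘ₖ F.kernel with hκ
  have hpost := measurable_posteriorBelief p κ
  have huk : ∀ k, Measurable fun a => u (k, a) := fun k =>
    hu.comp (measurable_const.prodMk measurable_id)
  have hsm : ∀ k, Measurable fun s => ∫ a, u (k, a) ∂(r (posteriorBelief p κ s)) := fun k =>
    ((huk k).stronglyMeasurable.integral_kernel (κ := r)).measurable.comp hpost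
  have hint : ∀ (k : Ω) (q : Belief Ω), Integrable (fun a => u (k, a)) (r q) := fun k q =>
    integrable_of_abs_le (huk k) fun a => hC (k, a)
  calc expectedUtility p u F G (beliefDrivenPolicy p r F G)
      = ∑ k, p.1 k * ∫ a, u (k, a) ∂((r.comap (posteriorBelief p κ) hpost ∘ₖ κ) k) := by
        unfold expectedUtility
        rw [Measure.integral_compProd (integrable_of_abs_le hu hC), Belief.integral_toMeasure]
        rfl
    _ = ∑ k, ∫ s, (posteriorBelief p κ s).1 k * ∫ a, u (k, a) ∂(r (posteriorBelief p κ s))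
          ∂(κ ∘ₘ p.toMeasure) := by
        refine Finset.sum_congr rfl fun k _ => ?_
        rw [Kernel.integral_comp (integrable_of_abs_le (huk k) fun a => hC (k, a)),
          integral_posteriorBelief_mul]
        rfl
    _ = ∫ s, indirectUtility r u (posteriorBelief p κ s) ∂(κ ∘ₘ p.toMeasure) := by
        rw [← integral_finsetSum]
        · refine integral_congr_ae (ae_of_all _ fun s => ?_)
          simp only [indirectUtility]
          rw [integral_finsetSum _ fun k _ => (hint k _).const_mul _]
          simp only [integral_const_mul]
        · intro k _
          refine (integrable_mul_coord (hsm k) hpost (C := C) (fun s => ?_) k).congr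
            (ae_of_all _ fun s => mul_comm _ _)
          exact abs_integral_le_of_abs_le fun a => hC (k, a)
    _ = _ := (integral_posteriorLaw p κ (measurable_indirectUtility r hu)).symm

end Payoff

/-! ### Equilibria and non-garbled belief distributions -/

section Equilibrium

variable {Ω : Type u} [Fintype Ω] [Nonempty Ω] [MeasurableSpace Ω] [DiscreteMeasurableSpace Ω]

/-- No garbling of the posterior that a mediator's optimal garbling leads to is worth more to the
mediator, since composing garblings yields a garbling. -/
theorem posteriorLaw_comp_mem_nonGarbled (p : Belief Ω) {v : Belief Ω → ℝ} {ε : ℝ}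
    {F : SignalingPolicy Ω} {G : SignalingPolicy F.Signal}
    (h : ∀ G' : SignalingPolicy F.Signal, ∫ q, v q ∂(posteriorLaw p (G'.kernel ∘ₖ F.kernel)) ≤
      ∫ q, v q ∂(posteriorLaw p (G.kernel ∘ₖ F.kernel)) + ε) :
    posteriorLaw p (G.kernel ∘ₖ F.kernel) ∈ nonGarbled v ε := by
  intro ν hν
  obtain ⟨G', rfl⟩ := exists_garbling p (G.kernel ∘ₖ F.kernel) hν
  have := h ⟨G'.Signal, G'.kernel ∘ₖ G.kernel⟩
  simp only [Kernel.comp_assoc] at this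
  linarith

theorem integral_posteriorLaw_comp_le_of_mem_nonGarbled (p : Belief Ω) {v : Belief Ω → ℝ} {ε : ℝ}
    {F : SignalingPolicy Ω} (h : posteriorLaw p F.kernel ∈ nonGarbled v ε)
    (G : SignalingPolicy F.Signal) :
    ∫ q, v q ∂(posteriorLaw p (G.kernel ∘ₖ F.kernel)) ≤
      ∫ q, v q ∂(posteriorLaw p F.kernel) + ε := by
  have := h _ (isMeanPreservingContraction_posteriorLaw_comp p F.kernel G.kernel)
  linarith

theorem posteriorLaw_fullRevelation (p : Belief Ω) (F : SignalingPolicy Ω) :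
    posteriorLaw p ((SignalingPolicy.fullRevelation F.Signal).kernel ∘ₖ F.kernel) =
      posteriorLaw p F.kernel := by
  change posteriorLaw p (Kernel.id ∘ₖ F.kernel) = posteriorLaw p F.kernel
  congr 1
  exact Kernel.id_comp F.kernel

variable {A : Type v} [MeasurableSpace A] (p : Belief Ω) {uS uM uR : Ω × A → ℝ}
  (huS : Measurable uS) (huS_bdd : ∃ C, ∀ x, |uS x| ≤ C)
  (huM : Measurable uM) (huM_bdd : ∃ C, ∀ x, |uM x| ≤ C)
  (r : Kernel (Belief Ω) A) [IsMarkovKernel r] {ε : ℝ}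

include huS huS_bdd huM huM_bdd

theorem senderValue_le_cav :
    senderValue p uS uM uR r ε ≤
      cav (nonGarbled (indirectUtility r uM) ε) (indirectUtility r uS) p := by
  refine iSup₂_le fun σ hσ => ?_
  have hpay : senderPayoff p uS σ = ∫ q, indirectUtility r uS q ∂(posteriorLaw p
      ((σ.mediator σ.sender).kernel ∘ₖ σ.sender.kernel)) := by
    unfold senderPayoff
    rw [hσ.belief_driven, expectedUtility_beliefDrivenPolicy p r huS huS_bdd]
  rw [hpay]
  refine le_iSup₂_of_le (posteriorLaw p ((σ.mediator σ.sender).kernel ∘ₖ σ.sender.kernel))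
    ⟨posteriorLaw_comp_mem_nonGarbled p fun G' => ?_, integral_coord_posteriorLaw p _⟩ le_rfl
  have := hσ.mediator_bestReply σ.sender G'
  rwa [hσ.belief_driven, hσ.belief_driven, expectedUtility_beliefDrivenPolicy p r huM huM_bdd,
    expectedUtility_beliefDrivenPolicy p r huM huM_bdd] at this

/-- If the mediator has `ε`-best replies, then every `ε`-optimal belief distribution in `𝓜^ε` is the
outcome of an equilibrium: the sender induces it and the mediator passes it on. -/
theorem exists_isRTSPE
    (hR : ∀ F G, IsReceiverBestReply p uR ε F G (beliefDrivenPolicy p r F G))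
    (hM : ∀ F : SignalingPolicy Ω, ∃ G : SignalingPolicy F.Signal,
      ∀ G' : SignalingPolicy F.Signal,
        ∫ q, indirectUtility r uM q ∂(posteriorLaw p (G'.kernel ∘ₖ F.kernel)) ≤
          ∫ q, indirectUtility r uM q ∂(posteriorLaw p (G.kernel ∘ₖ F.kernel)) + ε)
    {μ : ProbabilityMeasure (Belief Ω)} (hμ : μ ∈ nonGarbled (indirectUtility r uM) ε)
    (hμp : ∀ k, ∫ q : Belief Ω, q.1 k ∂μ = p.1 k)
    (hmax : ∀ μ' ∈ nonGarbled (indirectUtility r uM) ε,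
      (∀ k, ∫ q : Belief Ω, q.1 k ∂μ' = p.1 k) →
        ∫ q, indirectUtility r uS q ∂μ' ≤ ∫ q, indirectUtility r uS q ∂μ + ε) :
    ∃ σ : StrategyProfile Ω A, IsRTSPE p uS uM uR r ε σ ∧
      senderPayoff p uS σ = ∫ q, indirectUtility r uS q ∂μ := by
  classical
  obtain ⟨F₀, rfl⟩ := exists_posteriorLaw_eq p μ hμp
  choose G hG using hM
  let med : (F : SignalingPolicy Ω) → SignalingPolicy F.Signal := fun F =>
    if posteriorLaw p F.kernel ∈ nonGarbled (indirectUtility r uM) ε then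
      SignalingPolicy.fullRevelation F.Signal else G F
  let σ : StrategyProfile Ω A := ⟨F₀, med, beliefDrivenPolicy p r⟩
  have hmed_pos : ∀ F, posteriorLaw p F.kernel ∈ nonGarbled (indirectUtility r uM) ε →
      med F = SignalingPolicy.fullRevelation F.Signal := fun F hF => if_pos hF
  have hmed_neg : ∀ F, posteriorLaw p F.kernel ∉ nonGarbled (indirectUtility r uM) ε →
      med F = G F := fun F hF => if_neg hF
  have hmed : ∀ F, ∀ G' : SignalingPolicy F.Signal,
      ∫ q, indirectUtility r uM q ∂(posteriorLaw p (G'.kernel ∘ₖ F.kernel)) ≤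
        ∫ q, indirectUtility r uM q ∂(posteriorLaw p ((med F).kernel ∘ₖ F.kernel)) + ε := by
    intro F G'
    by_cases hF : posteriorLaw p F.kernel ∈ nonGarbled (indirectUtility r uM) ε
    · rw [hmed_pos F hF, posteriorLaw_fullRevelation]
      exact integral_posteriorLaw_comp_le_of_mem_nonGarbled p hF G'
    · rw [hmed_neg F hF]
      exact hG F G'
  have hS : ∀ F, expectedUtility p uS F (med F) (beliefDrivenPolicy p r F (med F)) =
      ∫ q, indirectUtility r uS q ∂(posteriorLaw p ((med F).kernel ∘ₖ F.kernel)) := fun F =>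
    expectedUtility_beliefDrivenPolicy p r huS huS_bdd F (med F)
  have hF₀ : posteriorLaw p ((med F₀).kernel ∘ₖ F₀.kernel) = posteriorLaw p F₀.kernel := by
    rw [hmed_pos F₀ hμ, posteriorLaw_fullRevelation]
  refine ⟨σ, ⟨?_, ?_, hR, ?_, fun _ _ => rfl⟩, ?_⟩
  · intro F
    change expectedUtility p uS F (med F) (beliefDrivenPolicy p r F (med F)) ≤
      expectedUtility p uS F₀ (med F₀) (beliefDrivenPolicy p r F₀ (med F₀)) + ε
    rw [hS, hS, hF₀]
    exact hmax _ (posteriorLaw_comp_mem_nonGarbled p (hmed F)) (integral_coord_posteriorLaw p _)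
  · intro F G'
    change expectedUtility p uM F G' (beliefDrivenPolicy p r F G') ≤
      expectedUtility p uM F (med F) (beliefDrivenPolicy p r F (med F)) + ε
    rw [expectedUtility_beliefDrivenPolicy p r huM huM_bdd,
      expectedUtility_beliefDrivenPolicy p r huM huM_bdd]
    exact hmed F G'
  · intro F hF
    have hmem : posteriorLaw p F.kernel ∈ nonGarbled (indirectUtility r uM) ε := by
      rw [← posteriorLaw_fullRevelation]
      refine posteriorLaw_comp_mem_nonGarbled p fun G' => ?_
      have := hF G'
      change expectedUtility p uM F G' (beliefDrivenPolicy p r F G') ≤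
        expectedUtility p uM F _ (beliefDrivenPolicy p r F _) + ε at this
      rwa [expectedUtility_beliefDrivenPolicy p r huM huM_bdd,
        expectedUtility_beliefDrivenPolicy p r huM huM_bdd] at this
    exact hmed_pos F hmem
  · change expectedUtility p uS F₀ (med F₀) (beliefDrivenPolicy p r F₀ (med F₀)) = _
    rw [hS, hF₀]

theorem senderValue_eq_cav_of_pos (hε : 0 < ε)
    (hR : ∀ F G, IsReceiverBestReply p uR ε F G (beliefDrivenPolicy p r F G)) :
    senderValue p uS uM uR r ε =
      cav (nonGarbled (indirectUtility r uM) ε) (indirectUtility r uS) p := by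
  refine le_antisymm (senderValue_le_cav p huS huS_bdd huM huM_bdd r) ?_
  obtain ⟨CS, hCS⟩ := huS_bdd
  obtain ⟨CM, hCM⟩ := huM_bdd
  have hM : ∀ F : SignalingPolicy Ω, ∃ G : SignalingPolicy F.Signal,
      ∀ G' : SignalingPolicy F.Signal,
        ∫ q, indirectUtility r uM q ∂(posteriorLaw p (G'.kernel ∘ₖ F.kernel)) ≤
          ∫ q, indirectUtility r uM q ∂(posteriorLaw p (G.kernel ∘ₖ F.kernel)) + ε := by
    intro F
    let T : Set ℝ := Set.range fun G : SignalingPolicy F.Signal =>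
      ∫ q, indirectUtility r uM q ∂(posteriorLaw p (G.kernel ∘ₖ F.kernel))
    have hne : T.Nonempty := ⟨_, SignalingPolicy.fullRevelation F.Signal, rfl⟩
    have hbdd : BddAbove T := by
      refine ⟨CM, ?_⟩
      rintro _ ⟨G, rfl⟩
      exact (abs_le.1 (abs_integral_le_of_abs_le (abs_indirectUtility_le r hCM))).2
    obtain ⟨_, ⟨G, rfl⟩, hG⟩ := exists_lt_of_lt_csSup hne (sub_lt_self (sSup T) hε)
    refine ⟨G, fun G' => ?_⟩
    have := le_csSup hbdd ⟨G', rfl⟩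
    simp only at hG this
    linarith
  refine iSup₂_le fun μ hμ => ?_
  -- Start from `μ` if it is `ε`-optimal for the sender, and from an `ε`-optimal improvement of it
  -- otherwise.
  obtain ⟨μ', hμ', hle, hmax⟩ : ∃ μ' : ProbabilityMeasure (Belief Ω),
      (μ' ∈ nonGarbled (indirectUtility r uM) ε ∧ ∀ k, ∫ q : Belief Ω, q.1 k ∂μ' = p.1 k) ∧
      ∫ q, indirectUtility r uS q ∂μ ≤ ∫ q, indirectUtility r uS q ∂μ' ∧
      ∀ μ'' ∈ nonGarbled (indirectUtility r uM) ε,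
        (∀ k, ∫ q : Belief Ω, q.1 k ∂μ'' = p.1 k) →
          ∫ q, indirectUtility r uS q ∂μ'' ≤ ∫ q, indirectUtility r uS q ∂μ' + ε := by
    let T : Set ℝ := (fun μ : ProbabilityMeasure (Belief Ω) => ∫ q, indirectUtility r uS q ∂μ) ''
      {μ | μ ∈ nonGarbled (indirectUtility r uM) ε ∧ ∀ k, ∫ q : Belief Ω, q.1 k ∂μ = p.1 k}
    have hne : T.Nonempty := ⟨_, μ, hμ, rfl⟩
    have hbdd : BddAbove T := by
      refine ⟨CS, ?_⟩
      rintro _ ⟨μ', -, rfl⟩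
      exact (abs_le.1 (abs_integral_le_of_abs_le (abs_indirectUtility_le r hCS))).2
    by_cases hopt : sSup T - ε ≤ ∫ q, indirectUtility r uS q ∂μ
    · refine ⟨μ, hμ, le_rfl, fun μ'' h1 h2 => ?_⟩
      have := le_csSup hbdd ⟨μ'', ⟨h1, h2⟩, rfl⟩
      simp only at this
      linarith
    · obtain ⟨_, ⟨μ', hμ', rfl⟩, hlt⟩ := exists_lt_of_lt_csSup hne (sub_lt_self (sSup T) hε)
      simp only at hlt
      refine ⟨μ', hμ', by linarith, fun μ'' h1 h2 => ?_⟩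
      have := le_csSup hbdd ⟨μ'', ⟨h1, h2⟩, rfl⟩
      simp only at this
      linarith
  obtain ⟨σ, hσ, hpay⟩ := exists_isRTSPE p huS ⟨CS, hCS⟩ huM ⟨CM, hCM⟩ r hR hM hμ'.1 hμ'.2 hmax
  refine le_iSup₂_of_le σ hσ ?_
  rw [hpay]
  exact_mod_cast hle

end Equilibrium

/-! ### Existence of an optimal garbling -/

section OptimalGarbling

variable {Ω : Type u} [Fintype Ω]

theorem isMeanPreservingContraction_refl (μ : ProbabilityMeasure (Belief Ω)) :
    IsMeanPreservingContraction μ μ := by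
  have hφ : Measurable fun q : Belief Ω => (q, q) := measurable_id.prodMk measurable_id
  have := Measure.isProbabilityMeasure_map (μ := (μ : Measure (Belief Ω))) hφ.aemeasurable
  refine isMeanPreservingContraction_of_coupling
    ((μ : Measure (Belief Ω)).map fun q => (q, q)) ?_ ?_ fun k f => ?_
  · rw [Measure.map_map measurable_fst hφ]
    exact Measure.map_id
  · rw [Measure.map_map measurable_snd hφ]
    exact Measure.map_id
  · rw [integral_map hφ.aemeasurable, integral_map hφ.aemeasurable]
    · exact ((f.continuous.measurable.comp measurable_fst).mul
        ((Belief.measurable_coord k).comp measurable_fst)).aestronglyMeasurable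
    · exact ((f.continuous.measurable.comp measurable_fst).mul
        ((Belief.measurable_coord k).comp measurable_snd)).aestronglyMeasurable

/-- The couplings that witness `ν ⪯ μ` for some `ν` form a weakly compact set, so a continuous
function has a best mean-preserving contraction. -/
theorem exists_optimal_contraction {v : Belief Ω → ℝ} (hv : Continuous v)
    (μ : ProbabilityMeasure (Belief Ω)) :
    ∃ ν, IsMeanPreservingContraction ν μ ∧
      ∀ ν', IsMeanPreservingContraction ν' μ → ∫ q, v q ∂ν' ≤ ∫ q, v q ∂ν := by
  have hfst : Continuous (Prod.fst : Belief Ω × Belief Ω → Belief Ω) := continuous_fst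
  have hsnd : Continuous (Prod.snd : Belief Ω × Belief Ω → Belief Ω) := continuous_snd
  have hcont : ∀ g : Belief Ω × Belief Ω → ℝ, Continuous g →
      Continuous fun γ : ProbabilityMeasure (Belief Ω × Belief Ω) => ∫ x, g x ∂γ := fun g hg =>
    ProbabilityMeasure.continuous_integral_boundedContinuousFunction
      (BoundedContinuousFunction.mkOfCompact ⟨g, hg⟩)
  let T : Set (ProbabilityMeasure (Belief Ω × Belief Ω)) :=
    {γ | γ.map hsnd.aemeasurable = μ} ∩
      ⋂ (k : Ω) (f : BoundedContinuousFunction (Belief Ω) ℝ),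
        {γ | ∫ x, f x.1 * x.2.1 k ∂(γ : Measure (Belief Ω × Belief Ω)) =
          ∫ x, f x.1 * x.1.1 k ∂(γ : Measure (Belief Ω × Belief Ω))}
  have hT : IsClosed T := by
    refine IsClosed.inter ?_ (isClosed_iInter fun k => isClosed_iInter fun f => ?_)
    · exact isClosed_eq (ProbabilityMeasure.continuous_map hsnd) continuous_const
    · exact isClosed_eq
        (hcont _ ((f.continuous.comp hfst).mul ((Belief.continuous_coord k).comp hsnd)))
        (hcont _ ((f.continuous.comp hfst).mul ((Belief.continuous_coord k).comp hfst)))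
  have hmem : ∀ {ν}, IsMeanPreservingContraction ν μ → ∃ γ ∈ T,
      ∫ q, v q ∂ν = ∫ x, v x.1 ∂(γ : Measure (Belief Ω × Belief Ω)) := by
    intro ν hν
    obtain ⟨γ, hγ, h1, h2, h3⟩ := hν.exists_coupling
    refine ⟨⟨γ, hγ⟩, ⟨Subtype.ext h2, Set.mem_iInter₂.2 fun k f => ?_⟩, ?_⟩
    · exact h3 k f ‖f‖ f.continuous.measurable fun q => f.norm_coe_le_norm q
    · rw [← h1, integral_map measurable_fst.aemeasurable hv.measurable.aestronglyMeasurable]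
      rfl
  obtain ⟨γ₀, hγ₀, -⟩ := hmem (isMeanPreservingContraction_refl μ)
  obtain ⟨γ, hγ, hmax⟩ := hT.isCompact.exists_isMaxOn ⟨γ₀, hγ₀⟩
    (hcont _ (hv.comp hfst)).continuousOn
  refine ⟨γ.map hfst.aemeasurable, ?_, fun ν' hν' => ?_⟩
  · exact isMeanPreservingContraction_of_coupling (γ : Measure (Belief Ω × Belief Ω)) rfl
      (congrArg Subtype.val hγ.1) fun k f => Set.mem_iInter₂.1 hγ.2 k f
  · obtain ⟨γ', hγ', heq⟩ := hmem hν'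
    rw [heq]
    refine (hmax hγ').trans_eq ?_
    rw [ProbabilityMeasure.toMeasure_map,
      integral_map hfst.aemeasurable hv.measurable.aestronglyMeasurable]
    rfl

end OptimalGarbling

/-! ### Splittings with at most `|Ω|` posteriors -/

section Splitting

variable {Ω : Type u} [Fintype Ω]

/-- A basic optimal solution: a splitting of `p` into finitely many beliefs can be replaced by one
into `|Ω|` of these beliefs with at least the same value. -/
theorem exists_mix_eq_of_sum (v : Belief Ω → ℝ) (p : Belief Ω) (n : ℕ) :
    ∀ (x : Fin n → Belief Ω) (w : Fin n → ℝ), (∀ i, 0 ≤ w i) → ∑ i, w i • (x i).1 = p.1 →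
      ∃ (q : Ω → Belief Ω) (α : Belief Ω), (∀ k, q k ∈ Set.range x) ∧ Belief.mix α q = p ∧
        ∑ i, w i * v (x i) ≤ ∑ k, α.1 k * v (q k) := by
  classical
  -- Weights summing to `p` sum to one, because the coordinates of a belief do.
  have hsum : ∀ {n : ℕ} (x : Fin n → Belief Ω) (w : Fin n → ℝ),
      ∑ k, (∑ i, w i • (x i).1) k = ∑ i, w i := by
    intro n x w
    simp only [Finset.sum_apply, Pi.smul_apply, smul_eq_mul]
    rw [Finset.sum_comm]
    simp [← Finset.mul_sum, (x _).2.2]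
  have hone : ∀ {n : ℕ} (x : Fin n → Belief Ω) (w : Fin n → ℝ), ∑ i, w i • (x i).1 = p.1 →
      ∑ i, w i = 1 := fun x w h => by rw [← hsum x w, h, p.2.2]
  induction n with
  | zero =>
    intro x w _ hp
    simpa using hone x w hp
  | succ n ih =>
    intro x w hw hp
    by_cases hn : n + 1 ≤ Fintype.card Ω
    · obtain ⟨e⟩ : Nonempty (Fin (n + 1) ↪ Ω) :=
        Function.Embedding.nonempty_of_card_le (by simpa using hn)
      let g : Ω → Fin (n + 1) := Function.invFun e
      have hge : ∀ i, g (e i) = i := Function.leftInverse_invFun e.injective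
      let a : Ω → ℝ := fun k => if e (g k) = k then w (g k) else 0
      have ha : ∀ h : Fin (n + 1) → ℝ, ∑ i, w i * h i = ∑ k, a k * h (g k) := by
        intro h
        refine Fintype.sum_of_injective e e.injective _ _ (fun k hk => ?_) fun i => ?_
        · have : e (g k) ≠ k := fun hek => hk ⟨_, hek⟩
          simp [a, this]
        · simp [a, hge]
      have ha1 : ∑ k, a k = 1 := by
        rw [← hone x w hp]
        simpa using (ha fun _ => 1).symm
      refine ⟨fun k => x (g k), ⟨a, fun k => ?_, ha1⟩, fun k => ⟨_, rfl⟩, ?_, ?_⟩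
      · simp only [a]
        split_ifs
        exacts [hw _, le_rfl]
      · refine Subtype.ext (funext fun j => ?_)
        rw [Belief.mix_coord, ← hp]
        simpa using (ha fun i => (x i).1 j).symm
      · exact (ha fun i => v (x i)).le
    · have hdep : ¬ LinearIndependent ℝ fun i => (x i).1 := by
        intro hli
        have := hli.fintype_card_le_finrank
        simp at this
        omega
      obtain ⟨c, hc, i₀, hi₀⟩ := Fintype.not_linearIndependent_iff.1 hdep
      -- Orient the linear relation so that moving along it does not lower the value.
      obtain ⟨c, hc, ⟨i₀, hi₀⟩, hcv⟩ : ∃ c : Fin (n + 1) → ℝ, ∑ i, c i • (x i).1 = 0 ∧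
          (∃ i, c i ≠ 0) ∧ 0 ≤ ∑ i, c i * v (x i) := by
        rcases le_total 0 (∑ i, c i * v (x i)) with h | h
        · exact ⟨c, hc, ⟨i₀, hi₀⟩, h⟩
        · refine ⟨-c, ?_, ⟨i₀, by simpa using hi₀⟩, ?_⟩
          · simpa using hc
          · simpa using h
      have hc0 : ∑ i, c i = 0 := by
        rw [← hsum x c, hc]
        simp
      obtain ⟨i₁, hi₁⟩ : ∃ i, c i < 0 := by
        by_contra! hpos
        exact hi₀ ((Finset.sum_eq_zero_iff_of_nonneg fun i _ => hpos i).1 hc0 i₀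
          (Finset.mem_univ _))
      -- The first weight to vanish along the relation.
      obtain ⟨m, hm, hmin⟩ := Finset.exists_min_image (Finset.univ.filter fun i => c i < 0)
        (fun i => w i / -c i) ⟨i₁, by simpa using hi₁⟩
      have hcm : c m < 0 := by simpa using hm
      set τ := w m / -c m with hτ
      have hτ0 : 0 ≤ τ := div_nonneg (hw m) (by linarith)
      have hw' : ∀ i, 0 ≤ w i + τ * c i := by
        intro i
        rcases lt_or_ge (c i) 0 with hi | hi
        · have h1 := hmin i (by simpa using hi)
          rw [le_div_iff₀ (by linarith)] at h1
          linarith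
        · exact add_nonneg (hw i) (mul_nonneg hτ0 hi)
      have hm0 : w m + τ * c m = 0 := by
        rw [hτ, div_neg, neg_mul, div_mul_cancel₀ _ hcm.ne, add_neg_cancel]
      obtain ⟨q, α, hq, hmix, hval⟩ := ih (fun i => x (m.succAbove i))
        (fun i => w (m.succAbove i) + τ * c (m.succAbove i)) (fun i => hw' _) (by
          have h1 : ∑ i, (w i + τ * c i) • (x i).1 = p.1 := by
            simp only [add_smul, mul_smul, Finset.sum_add_distrib, ← Finset.smul_sum, hc, hp,
              smul_zero, add_zero]
          rw [Fin.sum_univ_succAbove _ m, hm0, zero_smul, zero_add] at h1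
          exact h1)
      refine ⟨q, α, fun k => ?_, hmix, le_trans ?_ hval⟩
      · obtain ⟨i, hi⟩ := hq k
        exact ⟨_, hi⟩
      · have h1 : ∑ i, (w i + τ * c i) * v (x i) = ∑ i, w i * v (x i) + τ * ∑ i, c i * v (x i) := by
          rw [Finset.mul_sum, ← Finset.sum_add_distrib]
          exact Finset.sum_congr rfl fun i _ => by ring
        rw [Fin.sum_univ_succAbove _ m, hm0, zero_mul, zero_add] at h1
        rw [h1]
        exact le_add_of_nonneg_right (mul_nonneg hτ0 hcv)

theorem continuous_mix : Continuous fun y : (Ω → Belief Ω) × Belief Ω => Belief.mix y.2 y.1 := by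
  refine Continuous.subtype_mk (continuous_pi fun j => ?_) _
  simp only [Finset.sum_apply, Pi.smul_apply, smul_eq_mul]
  exact continuous_finsetSum _ fun k _ => ((Belief.continuous_coord k).comp continuous_snd).mul
    ((Belief.continuous_coord j).comp ((continuous_apply k).comp continuous_fst))

theorem upperSemicontinuous_sum_mul {v : Belief Ω → ℝ} (hv : UpperSemicontinuous v) :
    UpperSemicontinuous fun y : (Ω → Belief Ω) × Belief Ω => ∑ k, y.2.1 k * v (y.1 k) := by
  refine upperSemicontinuous_sum fun k _ => ?_
  rintro ⟨q₀, α₀⟩ c hc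
  simp only at hc
  -- A bound `t > v (q₀ k)` that still satisfies `α₀ k * t < c`.
  obtain ⟨t, ht, htc⟩ : ∃ t, v (q₀ k) < t ∧ α₀.1 k * t < c := by
    have hcont : Filter.Tendsto (fun t => α₀.1 k * t) (nhdsWithin (v (q₀ k)) (Set.Ioi (v (q₀ k))))
        (nhds (α₀.1 k * v (q₀ k))) :=
      ((continuous_const.mul continuous_id).tendsto _).mono_left nhdsWithin_le_nhds
    obtain ⟨t, h1, h2⟩ := ((hcont.eventually (gt_mem_nhds hc)).and
      (self_mem_nhdsWithin : Set.Ioi (v (q₀ k)) ∈ _)).exists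
    exact ⟨t, h2, h1⟩
  have h1 : ∀ᶠ y : (Ω → Belief Ω) × Belief Ω in nhds (q₀, α₀), v (y.1 k) < t :=
    (((continuous_apply k).comp continuous_fst).tendsto (q₀, α₀)).eventually (hv (q₀ k) t ht)
  have h2 : ∀ᶠ y : (Ω → Belief Ω) × Belief Ω in nhds (q₀, α₀), y.2.1 k * t < c :=
    ((((Belief.continuous_coord k).comp continuous_snd).mul continuous_const).tendsto
      (q₀, α₀)).eventually (gt_mem_nhds htc)
  filter_upwards [h1, h2] with y hy1 hy2
  exact (mul_le_mul_of_nonneg_left hy1.le (y.2.2.1 k)).trans_lt hy2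

/-- A distribution of beliefs concentrated on a closed set `K` can be replaced by a splitting of its
mean into `|Ω|` beliefs in `K` without lowering the value of an upper semicontinuous function. -/
theorem exists_splitting_of_ae_mem {v : Belief Ω → ℝ} (hv : UpperSemicontinuous v) {C : ℝ}
    (hC : ∀ q, |v q| ≤ C) {K : Set (Belief Ω)} (hK : IsClosed K) (p : Belief Ω)
    (μ : ProbabilityMeasure (Belief Ω)) (hμK : ∀ᵐ q ∂(μ : Measure (Belief Ω)), q ∈ K)
    (hμ : ∀ k, ∫ q : Belief Ω, q.1 k ∂μ = p.1 k) :
    ∃ (q : Ω → Belief Ω) (α : Belief Ω), (∀ k, q k ∈ K) ∧ Belief.mix α q = p ∧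
      ∫ q, v q ∂μ ≤ ∑ k, α.1 k * v (q k) := by
  classical
  -- The pairs `(x, t)` such that `x` has a splitting in `K` worth at least `t`.
  let H : Set ((Ω → ℝ) × ℝ) := {z | ∃ y : (Ω → Belief Ω) × Belief Ω, (∀ k, y.1 k ∈ K) ∧
    (Belief.mix y.2 y.1).1 = z.1 ∧ z.2 ≤ ∑ k, y.2.1 k * v (y.1 k)}
  have hclosed : IsClosed H := by
    let E : Set (((Ω → Belief Ω) × Belief Ω) × ((Ω → ℝ) × ℝ)) :=
      {e | (∀ k, e.1.1 k ∈ K) ∧ (Belief.mix e.1.2 e.1.1).1 = e.2.1 ∧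
        e.2.2 ≤ ∑ k, e.1.2.1 k * v (e.1.1 k)}
    have hE : IsClosed E := by
      refine IsClosed.inter ?_ (IsClosed.inter ?_ ?_)
      · have : {e : ((Ω → Belief Ω) × Belief Ω) × ((Ω → ℝ) × ℝ) | ∀ k, e.1.1 k ∈ K} =
            ⋂ k, {e | e.1.1 k ∈ K} := by
          ext e
          simp
        change IsClosed {e : ((Ω → Belief Ω) × Belief Ω) × ((Ω → ℝ) × ℝ) | ∀ k, e.1.1 k ∈ K}
        rw [this]
        exact isClosed_iInter fun k => hK.preimage
          ((continuous_apply k).comp (continuous_fst.comp continuous_fst))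
      · exact isClosed_eq (continuous_subtype_val.comp (continuous_mix.comp continuous_fst))
          (continuous_fst.comp continuous_snd)
      · exact ((upperSemicontinuous_sum_mul hv).IsClosed_hypograph).preimage
          (f := fun e : ((Ω → Belief Ω) × Belief Ω) × ((Ω → ℝ) × ℝ) => (e.1, e.2.2))
          (continuous_fst.prodMk (continuous_snd.comp continuous_snd))
    have : H = Prod.snd '' E := by
      ext z
      constructor
      · rintro ⟨y, hy⟩
        exact ⟨(y, z), hy, rfl⟩
      · rintro ⟨⟨y, z⟩, hy, rfl⟩
        exact ⟨y, hy⟩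
    rw [this]
    exact isClosedMap_snd_of_compactSpace _ hE
  have hconvex : Convex ℝ H := by
    rintro ⟨x₁, t₁⟩ ⟨⟨q₁, α₁⟩, hK₁, hx₁, ht₁⟩ ⟨x₂, t₂⟩ ⟨⟨q₂, α₂⟩, hK₂, hx₂, ht₂⟩ a b ha hb hab
    simp only at hK₁ hx₁ ht₁ hK₂ hx₂ ht₂
    subst hx₁ hx₂
    let e := (Fintype.equivFin (Ω ⊕ Ω)).symm
    let P : Belief Ω := ⟨a • (Belief.mix α₁ q₁).1 + b • (Belief.mix α₂ q₂).1,
      convex_stdSimplex ℝ Ω (Belief.mix α₁ q₁).2 (Belief.mix α₂ q₂).2 ha hb hab⟩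
    obtain ⟨q, α, hq, hmix, hval⟩ := exists_mix_eq_of_sum v P _
      (fun i => Sum.elim q₁ q₂ (e i))
      (fun i => Sum.elim (fun k => a * α₁.1 k) (fun k => b * α₂.1 k) (e i)) (fun i => by
        rcases e i with k | k
        · exact mul_nonneg ha (α₁.2.1 k)
        · exact mul_nonneg hb (α₂.2.1 k)) (by
        rw [e.sum_comp (fun s => Sum.elim (fun k => a * α₁.1 k) (fun k => b * α₂.1 k) s •
          (Sum.elim q₁ q₂ s).1), Fintype.sum_sum_type]
        simp [P, Belief.mix, mul_smul, Finset.smul_sum])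
    refine ⟨(q, α), fun k => ?_, ?_, ?_⟩
    · obtain ⟨i, hi⟩ := hq k
      change q k ∈ K
      rw [← hi]
      beta_reduce
      rcases e i with k | k
      · exact hK₁ k
      · exact hK₂ k
    · simp [hmix, P]
    · rw [e.sum_comp (fun s => Sum.elim (fun k => a * α₁.1 k) (fun k => b * α₂.1 k) s *
          v (Sum.elim q₁ q₂ s)), Fintype.sum_sum_type] at hval
      simp only [Sum.elim_inl, Sum.elim_inr, mul_assoc, ← Finset.mul_sum] at hval
      simp only [Prod.smul_mk, Prod.mk_add_mk, smul_eq_mul]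
      exact (add_le_add (mul_le_mul_of_nonneg_left ht₁ ha)
        (mul_le_mul_of_nonneg_left ht₂ hb)).trans hval
  have hmem : ∀ᵐ q ∂(μ : Measure (Belief Ω)), (q.1, v q) ∈ H := by
    filter_upwards [hμK] with q hq
    refine ⟨(fun _ => q, q), fun _ => hq, funext fun j => ?_, ?_⟩
    · rw [Belief.mix_coord]
      simp only [← Finset.sum_mul, q.2.2, one_mul]
    · simp only [← Finset.sum_mul, q.2.2, one_mul, le_refl]
  have hint₁ : Integrable (fun q : Belief Ω => q.1) (μ : Measure (Belief Ω)) :=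
    Integrable.of_eval fun k => integrable_of_abs_le (Belief.measurable_coord k)
      fun q => Belief.abs_coord_le_one q k
  have hint₂ : Integrable v (μ : Measure (Belief Ω)) := integrable_of_abs_le hv.measurable hC
  have := hconvex.integral_mem hclosed hmem (hint₁.prodMk hint₂)
  rw [integral_pair hint₁ hint₂] at this
  obtain ⟨⟨q, α⟩, hqK, hmix, hval⟩ := this
  refine ⟨q, α, hqK, Subtype.ext (hmix.trans (funext fun k => ?_)), hval⟩
  rw [← hμ k]
  exact eval_integral (f := fun q : Belief Ω => q.1) (fun k => integrable_of_abs_le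
    (Belief.measurable_coord k) fun q => Belief.abs_coord_le_one q k) k

end Splitting

/-! ### Supports of non-garbled distributions are affine dominating -/

section Pooling

variable {Ω : Type u} [Fintype Ω]

/-- Pooling: replacing a part `w · μ` of a non-garbled distribution by a point mass at its
barycenter `m` does not pay. -/
theorem mul_le_integral_of_mem_nonGarbled {v : Belief Ω → ℝ} (hv : Continuous v)
    {μ : ProbabilityMeasure (Belief Ω)} (hμ : μ ∈ nonGarbled v 0) {w : Belief Ω → ℝ}
    (hw : Measurable w) (hw0 : ∀ q, 0 ≤ w q) (hw1 : ∀ q, w q ≤ 1) {m : Belief Ω}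
    (hm : ∀ j, ∫ q, w q * q.1 j ∂μ = (∫ q, w q ∂μ) * m.1 j) :
    (∫ q, w q ∂μ) * v m ≤ ∫ q, w q * v q ∂μ := by
  have hw1' : ∀ q, 0 ≤ 1 - w q := fun q => sub_nonneg.2 (hw1 q)
  obtain ⟨C, hC⟩ : ∃ C, ∀ q, |v q| ≤ C :=
    ⟨‖BoundedContinuousFunction.mkOfCompact ⟨v, hv⟩‖, fun q =>
      (BoundedContinuousFunction.mkOfCompact ⟨v, hv⟩).norm_coe_le_norm q⟩
  let μ₁ : Measure (Belief Ω) := (μ : Measure (Belief Ω)).withDensity fun q => ENNReal.ofReal (w q)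
  let μ₂ : Measure (Belief Ω) :=
    (μ : Measure (Belief Ω)).withDensity fun q => ENNReal.ofReal (1 - w q)
  have hadd : μ₁ + μ₂ = μ := by
    rw [← withDensity_add_left hw.ennreal_ofReal]
    convert withDensity_one (μ := (μ : Measure (Belief Ω))) using 2
    ext q
    simp [← ENNReal.ofReal_add (hw0 q) (hw1' q)]
  have hfin₁ : IsFiniteMeasure μ₁ := isFiniteMeasure_of_le μ (by
    rw [← hadd]
    exact Measure.le_add_right le_rfl)
  have hfin₂ : IsFiniteMeasure μ₂ := isFiniteMeasure_of_le μ (by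
    rw [← hadd]
    exact Measure.le_add_left le_rfl)
  have hint₁ : ∀ g : Belief Ω → ℝ, ∫ q, g q ∂μ₁ = ∫ q, w q * g q ∂μ := by
    intro g
    rw [integral_withDensity_eq_integral_toReal_smul hw.ennreal_ofReal
      (ae_of_all _ fun _ => ENNReal.ofReal_lt_top)]
    simp only [ENNReal.toReal_ofReal (hw0 _), smul_eq_mul]
  have hφ₁ : Measurable fun q : Belief Ω => (m, q) := measurable_const.prodMk measurable_id
  have hφ₂ : Measurable fun q : Belief Ω => (q, q) := measurable_id.prodMk measurable_id
  let γ : Measure (Belief Ω × Belief Ω) := μ₁.map (fun q => (m, q)) + μ₂.map fun q => (q, q)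
  have hγ : ∀ (g : Belief Ω × Belief Ω → ℝ) (C : ℝ), Measurable g → (∀ x, |g x| ≤ C) →
      ∫ x, g x ∂γ = ∫ q, g (m, q) ∂μ₁ + ∫ q, g (q, q) ∂μ₂ := by
    intro g C hg hC
    rw [integral_add_measure (integrable_of_abs_le hg hC) (integrable_of_abs_le hg hC),
      integral_map hφ₁.aemeasurable hg.aestronglyMeasurable,
      integral_map hφ₂.aemeasurable hg.aestronglyMeasurable]
  have hsnd : γ.map Prod.snd = μ := by
    rw [Measure.map_add _ _ measurable_snd, Measure.map_map measurable_snd hφ₁,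
      Measure.map_map measurable_snd hφ₂, ← hadd]
    exact congrArg₂ _ Measure.map_id Measure.map_id
  have hprob : IsProbabilityMeasure γ := by
    constructor
    rw [← Set.preimage_univ (f := Prod.snd), ← Measure.map_apply measurable_snd MeasurableSet.univ,
      hsnd, measure_univ]
  let ν : ProbabilityMeasure (Belief Ω) :=
    ⟨γ.map Prod.fst, Measure.isProbabilityMeasure_map measurable_fst.aemeasurable⟩
  have hν : IsMeanPreservingContraction ν μ := by
    refine isMeanPreservingContraction_of_coupling γ rfl hsnd fun k f => ?_
    have hf : ∀ q, |f q| ≤ ‖f‖ := fun q => f.norm_coe_le_norm q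
    have hfb : ∀ q q' : Belief Ω, |f q * q'.1 k| ≤ ‖f‖ := fun q q' => by
      rw [abs_mul]
      exact (mul_le_of_le_one_right (abs_nonneg _) (q'.abs_coord_le_one k)).trans (hf q)
    rw [hγ (fun x => f x.1 * x.2.1 k) ‖f‖ ((f.continuous.measurable.comp measurable_fst).mul
        ((Belief.measurable_coord k).comp measurable_snd)) fun x => hfb _ _,
      hγ (fun x => f x.1 * x.1.1 k) ‖f‖ ((f.continuous.measurable.comp measurable_fst).mul
        ((Belief.measurable_coord k).comp measurable_fst)) fun x => hfb _ _]
    congr 1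
    simp only [integral_const_mul]
    rw [hint₁, hm k, integral_const]
    have : μ₁.real Set.univ = ∫ q, w q ∂μ := by
      have := hint₁ fun _ => 1
      simpa using this
    rw [this, smul_eq_mul]
  have h1 := hμ ν hν
  have hνint : ∫ q, v q ∂ν = (∫ q, w q ∂μ) * v m + ∫ q, v q ∂μ₂ := by
    change ∫ q, v q ∂(γ.map Prod.fst) = _
    rw [integral_map measurable_fst.aemeasurable hv.measurable.aestronglyMeasurable,
      hγ (fun x => v x.1) C (hv.measurable.comp measurable_fst) fun x => hC _, hint₁]
    simp only [integral_mul_const]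
  have hμint : ∫ q, v q ∂μ = ∫ q, w q * v q ∂μ + ∫ q, v q ∂μ₂ := by
    rw [← hint₁, ← integral_add_measure (integrable_of_abs_le hv.measurable hC)
      (integrable_of_abs_le hv.measurable hC), hadd]
  rw [hνint, hμint] at h1
  linarith

/-- If pooling beliefs near `q k` in the proportions `α k` raised the value of `v`, then a
distribution charging every neighborhood of every `q k` would have a profitable garbling. -/
theorem affineDominating_of_mem_support {v : Belief Ω → ℝ} (hv : Continuous v)
    {μ : ProbabilityMeasure (Belief Ω)} (hμ : μ ∈ nonGarbled v 0) {q : Ω → Belief Ω}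
    (hq : ∀ k, q k ∈ (μ : Measure (Belief Ω)).support) : AffineDominating v q := by
  classical
  intro α
  by_contra! hlt
  set m₀ := Belief.mix α q with hm₀
  obtain ⟨η, hη, hη3⟩ : ∃ η > 0, ∑ k, α.1 k * v (q k) + 2 * η < v m₀ :=
    ⟨(v m₀ - ∑ k, α.1 k * v (q k)) / 3, by linarith, by linarith⟩
  obtain ⟨ρ, hρ, hρv⟩ : ∃ ρ > 0, ∀ y : Belief Ω, dist y m₀ ≤ ρ → v m₀ - η < v y := by
    have := Metric.nhds_basis_closedBall.eventually_iff.1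
      (hv.continuousAt.eventually (lt_mem_nhds (sub_lt_self (v m₀) hη)))
    obtain ⟨ρ, hρ, h⟩ := this
    exact ⟨ρ, hρ, fun y hy => h hy⟩
  let U : Ω → Set (Belief Ω) := fun k => {x | v x < v (q k) + η} ∩ Metric.ball (q k) ρ
  have hUopen : ∀ k, IsOpen (U k) := fun k =>
    (isOpen_lt hv continuous_const).inter Metric.isOpen_ball
  have hUmeas : ∀ k, MeasurableSet (U k) := fun k => (hUopen k).measurableSet
  have hqU : ∀ k, q k ∈ U k := fun k => ⟨by simpa using hη, Metric.mem_ball_self hρ⟩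
  let c : Ω → ℝ := fun k => (μ : Measure (Belief Ω)).real (U k)
  have hc : ∀ k, 0 < c k := fun k => ENNReal.toReal_pos
    ((Measure.mem_support_iff_forall _).1 (hq k) _ ((hUopen k).mem_nhds (hqU k))).ne'
    (measure_ne_top _ _)
  -- The average of `g` over `U k`.
  let avg : Ω → (Belief Ω → ℝ) → ℝ := fun k g => (∫ x in U k, g x ∂μ) / c k
  have havg_le : ∀ (k : Ω) (g : Belief Ω → ℝ), Continuous g → ∀ b, (∀ x ∈ U k, g x ≤ b) →
      avg k g ≤ b := by
    intro k g hg b hb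
    rw [div_le_iff₀ (hc k)]
    have hI : Integrable g (μ : Measure (Belief Ω)) :=
      integrable_of_abs_le hg.measurable fun x =>
        (BoundedContinuousFunction.mkOfCompact ⟨g, hg⟩).norm_coe_le_norm x
    have := setIntegral_mono_on hI.integrableOn
      (integrable_const b : Integrable _ (μ : Measure (Belief Ω))).integrableOn (hUmeas k) hb
    rwa [setIntegral_const, smul_eq_mul, mul_comm] at this
  have havg_abs : ∀ k j, |avg k (fun x => x.1 j) - (q k).1 j| ≤ ρ := by
    intro k j
    have hd : ∀ x ∈ U k, |x.1 j - (q k).1 j| ≤ ρ := fun x hx =>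
      (dist_le_pi_dist x.1 (q k).1 j).trans (Metric.mem_ball.1 hx.2).le
    have h1 := havg_le k (fun x => x.1 j) (Belief.continuous_coord j) ((q k).1 j + ρ)
      fun x hx => by linarith [(abs_le.1 (hd x hx)).2]
    have h2 := havg_le k (fun x => -x.1 j) (Belief.continuous_coord j).neg (-(q k).1 j + ρ)
      fun x hx => by linarith [(abs_le.1 (hd x hx)).1]
    have h3 : avg k (fun x => -x.1 j) = -avg k fun x => x.1 j := by
      simp only [avg, integral_neg, neg_div]
    rw [abs_le]
    constructor <;> linarith
  -- The pooled weight: a fraction `δ` of the mass, taken from `U k` in the proportion `α k`.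
  have hne : Nonempty Ω := by
    by_contra hempty
    rw [not_nonempty_iff] at hempty
    simpa using α.2.2
  obtain ⟨k₀, -, hk₀⟩ := Finset.exists_min_image Finset.univ c Finset.univ_nonempty
  set δ := c k₀ with hδ
  have hδ0 : 0 < δ := hc k₀
  let w : Belief Ω → ℝ := fun x => ∑ k, δ * α.1 k / c k * (U k).indicator (fun _ => 1) x
  have hcoef : ∀ k, 0 ≤ δ * α.1 k / c k := fun k =>
    div_nonneg (mul_nonneg hδ0.le (α.2.1 k)) (hc k).le
  have hw : Measurable w := Finset.measurable_fun_sum _ fun k _ =>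
    (measurable_const.indicator (hUmeas k)).const_mul _
  have hw0 : ∀ x, 0 ≤ w x := fun x => Finset.sum_nonneg fun k _ =>
    mul_nonneg (hcoef k) (Set.indicator_nonneg (fun _ _ => zero_le_one) x)
  have hw1 : ∀ x, w x ≤ 1 := by
    intro x
    rw [← α.2.2]
    refine Finset.sum_le_sum fun k _ => ?_
    calc δ * α.1 k / c k * (U k).indicator (fun _ => 1) x ≤ δ * α.1 k / c k * 1 :=
          mul_le_mul_of_nonneg_left (Set.indicator_le_self' (fun _ _ => zero_le_one) x) (hcoef k)
      _ ≤ α.1 k := by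
          rw [mul_one, div_le_iff₀ (hc k), mul_comm]
          exact mul_le_mul_of_nonneg_left (hk₀ k (Finset.mem_univ k)) (α.2.1 k)
  have hwint : ∀ g : Belief Ω → ℝ, Continuous g →
      ∫ x, w x * g x ∂μ = δ * ∑ k, α.1 k * avg k g := by
    intro g hg
    have hI : Integrable g (μ : Measure (Belief Ω)) :=
      integrable_of_abs_le hg.measurable fun x =>
        (BoundedContinuousFunction.mkOfCompact ⟨g, hg⟩).norm_coe_le_norm x
    have h1 : ∀ x, w x * g x = ∑ k, δ * α.1 k / c k * (U k).indicator g x := by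
      intro x
      simp only [w, Finset.sum_mul]
      refine Finset.sum_congr rfl fun k _ => ?_
      by_cases hx : x ∈ U k <;> simp [hx]
    simp only [h1]
    rw [integral_finsetSum _ fun k _ => (hI.indicator (hUmeas k)).const_mul _, Finset.mul_sum]
    refine Finset.sum_congr rfl fun k _ => ?_
    rw [integral_const_mul, integral_indicator (hUmeas k)]
    simp only [avg]
    ring
  have havg_one : ∀ k, avg k (fun _ => 1) = 1 := by
    intro k
    simp only [avg, setIntegral_const, smul_eq_mul, mul_one]
    exact div_self (hc k).ne'
  have hwtot : ∫ x, w x ∂μ = δ := by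
    have := hwint (fun _ => 1) continuous_const
    simpa only [mul_one, havg_one, α.2.2] using this
  let m : Belief Ω := ⟨fun j => ∑ k, α.1 k * avg k fun x => x.1 j,
    fun j => Finset.sum_nonneg fun k _ => mul_nonneg (α.2.1 k)
      (div_nonneg (integral_nonneg fun x => x.2.1 j) (hc k).le), by
      have h1 : ∀ k, ∑ j, avg k (fun x => x.1 j) = 1 := by
        intro k
        rw [← havg_one k]
        simp only [avg]
        rw [← Finset.sum_div, ← integral_finsetSum]
        · simp only [(Subtype.prop _ : _ ∈ stdSimplex ℝ Ω).2]
        · intro j _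
          exact (integrable_of_abs_le (Belief.measurable_coord j)
            fun q => Belief.abs_coord_le_one q j).integrableOn
      rw [Finset.sum_comm]
      simp only [← Finset.mul_sum, h1, mul_one, α.2.2]⟩
  have hpool := mul_le_integral_of_mem_nonGarbled hv hμ hw hw0 hw1 (m := m) fun j => by
    rw [hwtot]
    exact hwint _ (Belief.continuous_coord j)
  rw [hwtot, hwint v hv] at hpool
  have hvm : v m ≤ ∑ k, α.1 k * avg k v := le_of_mul_le_mul_left hpool hδ0
  have hsum : ∑ k, α.1 k * avg k v ≤ ∑ k, α.1 k * v (q k) + η := by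
    calc ∑ k, α.1 k * avg k v ≤ ∑ k, α.1 k * (v (q k) + η) :=
          Finset.sum_le_sum fun k _ => mul_le_mul_of_nonneg_left
            (havg_le k v hv _ fun x hx => (show v x < v (q k) + η from hx.1).le) (α.2.1 k)
      _ = _ := by simp only [mul_add, Finset.sum_add_distrib, ← Finset.sum_mul, α.2.2, one_mul]
  have hdist : dist m m₀ ≤ ρ := by
    refine (dist_pi_le_iff hρ.le).2 fun j => ?_
    change |(∑ k, α.1 k * avg k fun x => x.1 j) - m₀.1 j| ≤ ρ
    rw [hm₀, Belief.mix_coord, ← Finset.sum_sub_distrib]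
    simp only [← mul_sub]
    exact α.abs_sum_mul_le fun k => havg_abs k j
  have := hρv m hdist
  linarith

end Pooling

/-! ### Affine dominating splittings are non-garbled -/

section AffineDominating

variable {Ω : Type u} [Fintype Ω]

theorem AffineDominating.comp {v : Belief Ω → ℝ} {q : Ω → Belief Ω} (h : AffineDominating v q)
    (φ : Ω → Ω) : AffineDominating v (q ∘ φ) := by
  classical
  intro α
  let b : Ω → ℝ := fun j => ∑ k, if φ k = j then α.1 k else 0
  have hb : ∀ g : Ω → ℝ, ∑ j, b j * g j = ∑ k, α.1 k * g (φ k) := by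
    intro g
    simp only [b, Finset.sum_mul]
    rw [Finset.sum_comm]
    simp [ite_mul]
  let β : Belief Ω := ⟨b, fun j => Finset.sum_nonneg fun k _ => by
    split_ifs
    exacts [α.2.1 k, le_rfl], by simpa [α.2.2] using hb fun _ => 1⟩
  have hmix : Belief.mix α (q ∘ φ) = Belief.mix β q := by
    refine Subtype.ext (funext fun j => ?_)
    rw [Belief.mix_coord, Belief.mix_coord]
    exact (hb fun k => (q k).1 j).symm
  rw [hmix]
  exact (h β).trans_eq (hb fun k => v (q k))

/-- Jensen's inequality for a distribution concentrated on an affine dominating family. -/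
theorem AffineDominating.le_integral {v : Belief Ω → ℝ} (hv : Continuous v) {q : Ω → Belief Ω}
    (h : AffineDominating v q) {x : Belief Ω} (μ : ProbabilityMeasure (Belief Ω))
    (hμ : ∀ᵐ y ∂(μ : Measure (Belief Ω)), y ∈ Set.range q)
    (hx : ∀ k, ∫ y : Belief Ω, y.1 k ∂μ = x.1 k) : v x ≤ ∫ y, v y ∂μ := by
  obtain ⟨q', α, hq', hmix, hval⟩ := exists_splitting_of_ae_mem (v := fun y => -v y)
    hv.neg.upperSemicontinuous
    (fun y => (BoundedContinuousFunction.mkOfCompact ⟨fun y => -v y, hv.neg⟩).norm_coe_le_norm y)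
    (Set.finite_range q).isClosed x μ hμ hx
  choose φ hφ using hq'
  obtain rfl : q' = q ∘ φ := funext fun k => (hφ k).symm
  have h1 := h.comp φ α
  rw [hmix] at h1
  simp only [integral_neg, mul_neg, Finset.sum_neg_distrib] at hval
  linarith

variable [MeasurableSpace Ω] [DiscreteMeasurableSpace Ω]

/-- The distribution `∑ₖ αₖ δ_{qₖ}` of beliefs. -/
noncomputable def splittingLaw (α : Belief Ω) (q : Ω → Belief Ω) : ProbabilityMeasure (Belief Ω) :=
  ⟨α.toMeasure.map q, Measure.isProbabilityMeasure_map Measurable.of_discrete.aemeasurable⟩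

theorem integral_splittingLaw (α : Belief Ω) (q : Ω → Belief Ω) {f : Belief Ω → ℝ}
    (hf : Measurable f) : ∫ x, f x ∂(splittingLaw α q) = ∑ k, α.1 k * f (q k) := by
  change ∫ x, f x ∂(α.toMeasure.map q) = _
  rw [integral_map Measurable.of_discrete.aemeasurable hf.aestronglyMeasurable,
    Belief.integral_toMeasure]

theorem AffineDominating.splittingLaw_mem_nonGarbled {v : Belief Ω → ℝ} (hv : Continuous v)
    {q : Ω → Belief Ω} (h : AffineDominating v q) (α : Belief Ω) :
    splittingLaw α q ∈ nonGarbled v 0 := by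
  intro ν hν
  obtain ⟨γ, hγ, h1, h2, h3⟩ := hν.exists_coupling
  have hne : Nonempty (Belief Ω) := ⟨α⟩
  obtain ⟨C, hC⟩ : ∃ C, ∀ q, |v q| ≤ C :=
    ⟨‖BoundedContinuousFunction.mkOfCompact ⟨v, hv⟩‖, fun q =>
      (BoundedContinuousFunction.mkOfCompact ⟨v, hv⟩).norm_coe_le_norm q⟩
  let K := γ.condKernel
  have hdis : (ν : Measure (Belief Ω)) ⊗ₘ K = γ := by
    rw [← h1]
    exact Measure.disintegrate _ _
  have hrange : MeasurableSet (Set.range q) := (Set.finite_range q).measurableSet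
  have hK : ∀ᵐ x ∂(ν : Measure (Belief Ω)), ∀ᵐ y ∂(K x), y ∈ Set.range q := by
    have hsupp : ∀ᵐ x ∂((ν : Measure (Belief Ω)) ⊗ₘ K), x.2 ∈ Set.range q := by
      rw [hdis]
      refine ae_of_ae_map (f := Prod.snd) (p := fun y => y ∈ Set.range q)
        measurable_snd.aemeasurable ?_
      rw [h2]
      change ∀ᵐ y ∂(α.toMeasure.map q), y ∈ Set.range q
      exact (ae_map_iff (p := fun y => y ∈ Set.range q) Measurable.of_discrete.aemeasurable
        hrange).2 (ae_of_all _ fun k => ⟨k, rfl⟩)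
    exact Measure.ae_ae_of_ae_compProd hsupp
  have hsm : ∀ {g : Belief Ω → ℝ}, Measurable g → Measurable fun x => ∫ y, g y ∂(K x) := fun hg =>
    (hg.stronglyMeasurable.integral_kernel (κ := K)).measurable
  have hmean : ∀ k, ∀ᵐ x ∂(ν : Measure (Belief Ω)), ∫ y : Belief Ω, y.1 k ∂(K x) = x.1 k := by
    intro k
    refine Integrable.ae_eq_of_forall_setIntegral_eq _ _
      (integrable_of_abs_le (C := 1) (hsm (Belief.measurable_coord k))
        fun x => abs_integral_le_of_abs_le fun y => y.abs_coord_le_one k)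
      (integrable_of_abs_le (Belief.measurable_coord k) fun x => x.abs_coord_le_one k) ?_
    intro B hB _
    have hBm : Measurable (B.indicator fun _ => (1 : ℝ)) := measurable_const.indicator hB
    have hB1 : ∀ x, |B.indicator (fun _ => (1 : ℝ)) x| ≤ 1 := by
      intro x
      by_cases hx : x ∈ B <;> simp [hx]
    have h4 := h3 k _ 1 hBm hB1
    rw [← integral_map (φ := Prod.fst) (f := fun x => B.indicator (fun _ => (1 : ℝ)) x * x.1 k)
      measurable_fst.aemeasurable (hBm.mul (Belief.measurable_coord k)).aestronglyMeasurable, h1,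
      ← hdis, Measure.integral_compProd
        (f := fun x : Belief Ω × Belief Ω => B.indicator (fun _ => (1 : ℝ)) x.1 * x.2.1 k)
        (integrable_mul_coord (hBm.comp measurable_fst) measurable_snd (fun x => hB1 x.1) k)] at h4
    simp only [integral_const_mul] at h4
    rw [← integral_indicator hB, ← integral_indicator hB]
    convert h4 using 2 <;>
    · ext x
      by_cases hx : x ∈ B <;> simp [hx]
  have hle : ∀ᵐ x ∂(ν : Measure (Belief Ω)), v x ≤ ∫ y, v y ∂(K x) := by
    filter_upwards [hK, ae_all_iff.2 hmean] with x hx hx'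
    exact h.le_integral hv ⟨K x, inferInstance⟩ hx hx'
  rw [sub_zero]
  calc ∫ x, v x ∂ν ≤ ∫ x, ∫ y, v y ∂(K x) ∂ν :=
        integral_mono_ae (integrable_of_abs_le hv.measurable hC)
          (integrable_of_abs_le (hsm hv.measurable) fun x => abs_integral_le_of_abs_le hC) hle
    _ = ∫ x, v x.2 ∂γ := by
        rw [← hdis, Measure.integral_compProd]
        exact integrable_of_abs_le (hv.measurable.comp measurable_snd) fun x => hC _
    _ = ∫ x, v x ∂(splittingLaw α q) := by
        rw [← h2, integral_map measurable_snd.aemeasurable hv.measurable.aestronglyMeasurable]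

end AffineDominating

/-! ### The constrained concavification -/

section Concavification

variable {Ω : Type u} [Fintype Ω]

theorem isClosed_affineDominating {v : Belief Ω → ℝ} (hv : Continuous v) :
    IsClosed {q : Ω → Belief Ω | AffineDominating v q} := by
  have : {q : Ω → Belief Ω | AffineDominating v q} =
      ⋂ α, {q | v (Belief.mix α q) ≤ ∑ k, α.1 k * v (q k)} := by
    ext q
    simp [AffineDominating]
  rw [this]
  refine isClosed_iInter fun α => isClosed_le
    (hv.comp (continuous_mix.comp (continuous_id.prodMk continuous_const))) ?_
  exact continuous_finsetSum _ fun k _ => continuous_const.mul (hv.comp (continuous_apply k))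

theorem exists_isGreatest_splittingValues {v f : Belief Ω → ℝ} (hv : Continuous v)
    (hf : UpperSemicontinuous f) (p : Belief Ω) :
    ∃ x, IsGreatest (splittingValues {q | AffineDominating v q} f p) x := by
  let T : Set ((Ω → Belief Ω) × Belief Ω) :=
    {y | AffineDominating v y.1} ∩ {y | Belief.mix y.2 y.1 = p}
  have hT : IsClosed T := ((isClosed_affineDominating hv).preimage continuous_fst).inter
    (isClosed_eq continuous_mix continuous_const)
  have hmix : ∀ α : Belief Ω, Belief.mix α (fun _ => p) = p := fun α =>
    Subtype.ext (funext fun j => by rw [Belief.mix_coord, ← Finset.sum_mul, α.2.2, one_mul])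
  have hne : T.Nonempty := by
    refine ⟨(fun _ => p, p), fun α => ?_, hmix p⟩
    rw [hmix]
    simp only [← Finset.sum_mul, α.2.2, one_mul, le_refl]
  obtain ⟨⟨q, α⟩, hqα, hmax⟩ := ((upperSemicontinuous_sum_mul hf).upperSemicontinuousOn
    T).exists_isMaxOn hne hT.isCompact
  refine ⟨_, ⟨q, hqα.1, α, hqα.2, rfl⟩, ?_⟩
  rintro _ ⟨q', hq', α', hα', rfl⟩
  exact hmax (show (q', α') ∈ T from ⟨hq', hα'⟩)

/-- A non-garbled distribution is worth no more than some splitting into affine dominating beliefs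
from its support. -/
theorem exists_splittingValues_ge {v f : Belief Ω → ℝ} (hv : Continuous v)
    (hf : UpperSemicontinuous f) {C : ℝ} (hC : ∀ q, |f q| ≤ C) {p : Belief Ω}
    {μ : ProbabilityMeasure (Belief Ω)} (hμ : μ ∈ nonGarbled v 0)
    (hμp : ∀ k, ∫ q : Belief Ω, q.1 k ∂μ = p.1 k) :
    ∃ x ∈ splittingValues {q | AffineDominating v q} f p, ∫ q, f q ∂μ ≤ x := by
  obtain ⟨q, α, hq, hmix, hval⟩ := exists_splitting_of_ae_mem hf hC
    (Measure.isClosed_support (μ := (μ : Measure (Belief Ω)))) p μ Measure.support_mem_ae hμp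
  exact ⟨_, ⟨q, affineDominating_of_mem_support hv hμ hq, α, hmix, rfl⟩, hval⟩

end Concavification

end MediatedPersuasion

open MediatedPersuasion in
theorem theorem1 {Ω : Type u} [Fintype Ω] [Nonempty Ω] [MeasurableSpace Ω]
    [DiscreteMeasurableSpace Ω] {A : Type v} [MeasurableSpace A] (p : Belief Ω)
    (uS uM uR : Ω × A → ℝ)
    (huS : Measurable uS) (huS_bdd : ∃ C, ∀ x, |uS x| ≤ C)
    (huM : Measurable uM) (huM_bdd : ∃ C, ∀ x, |uM x| ≤ C)
    (huR : Measurable uR) (huR_bdd : ∃ C, ∀ x, |uR x| ≤ C)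
    (r : Kernel (Belief Ω) A) [IsMarkovKernel r] :
    (∀ ε : ℝ, 0 < ε →
      (∀ F G, IsReceiverBestReply p uR ε F G (beliefDrivenPolicy p r F G)) →
      senderValue p uS uM uR r ε =
        cav (nonGarbled (indirectUtility r uM) ε) (indirectUtility r uS) p) ∧
    ((∀ F G, IsReceiverBestReply p uR 0 F G (beliefDrivenPolicy p r F G)) →
      UpperSemicontinuous (indirectUtility r uS) →
      Continuous (indirectUtility r uM) →
      (∃ σ : StrategyProfile Ω A, IsRTSPE p uS uM uR r 0 σ ∧
        (senderPayoff p uS σ : EReal) = senderValue p uS uM uR r 0) ∧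
      senderValue p uS uM uR r 0 =
        cav (nonGarbled (indirectUtility r uM) 0) (indirectUtility r uS) p ∧
      ∃ x : ℝ,
        IsGreatest (splittingValues {q | AffineDominating (indirectUtility r uM) q}
          (indirectUtility r uS) p) x ∧
        senderValue p uS uM uR r 0 = x) := by
  refine ⟨fun ε hε hR => senderValue_eq_cav_of_pos p huS huS_bdd huM huM_bdd r hε hR,
    fun hR hvS hvM => ?_⟩
  obtain ⟨C, hC⟩ := huS_bdd
  have hCS := abs_indirectUtility_le r hC
  obtain ⟨x, hx⟩ := exists_isGreatest_splittingValues hvM hvS p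
  have hub : ∀ μ ∈ nonGarbled (indirectUtility r uM) 0,
      (∀ k, ∫ q : Belief Ω, q.1 k ∂μ = p.1 k) → ∫ q, indirectUtility r uS q ∂μ ≤ x := by
    intro μ hμ hμp
    obtain ⟨y, hy, hle⟩ := exists_splittingValues_ge hvM hvS hCS hμ hμp
    exact hle.trans (hx.2 hy)
  have hcav : cav (nonGarbled (indirectUtility r uM) 0) (indirectUtility r uS) p ≤ x :=
    iSup₂_le fun μ hμ => EReal.coe_le_coe_iff.2 (hub μ hμ.1 hμ.2)
  obtain ⟨q, hq, α, hmix, hxq⟩ := hx.1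
  have hpay : ∫ y, indirectUtility r uS y ∂(splittingLaw α q) = x := by
    rw [integral_splittingLaw α q hvS.measurable, hxq]
  have hmean : ∀ k, ∫ y : Belief Ω, y.1 k ∂(splittingLaw α q) = p.1 k := by
    intro k
    rw [integral_splittingLaw α q (Belief.measurable_coord k), ← Belief.mix_coord, hmix]
  have hM : ∀ F : SignalingPolicy Ω, ∃ G : SignalingPolicy F.Signal,
      ∀ G' : SignalingPolicy F.Signal,
        ∫ y, indirectUtility r uM y ∂(posteriorLaw p (G'.kernel ∘ₖ F.kernel)) ≤
          ∫ y, indirectUtility r uM y ∂(posteriorLaw p (G.kernel ∘ₖ F.kernel)) + 0 := by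
    intro F
    obtain ⟨ν, hν, hopt⟩ := exists_optimal_contraction hvM (posteriorLaw p F.kernel)
    obtain ⟨G, rfl⟩ := exists_garbling p F.kernel hν
    refine ⟨G, fun G' => ?_⟩
    rw [add_zero]
    exact hopt _ (isMeanPreservingContraction_posteriorLaw_comp p F.kernel G'.kernel)
  obtain ⟨σ, hσ, hσx⟩ := exists_isRTSPE p huS ⟨C, hC⟩ huM huM_bdd r hR hM
    (hq.splittingLaw_mem_nonGarbled hvM α) hmean fun μ' h1 h2 => by
      rw [add_zero, hpay]
      exact hub μ' h1 h2
  rw [hpay] at hσx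
  have hle : senderValue p uS uM uR r 0 ≤
      cav (nonGarbled (indirectUtility r uM) 0) (indirectUtility r uS) p :=
    senderValue_le_cav p huS ⟨C, hC⟩ huM huM_bdd r
  have hge : (x : EReal) ≤ senderValue p uS uM uR r 0 :=
    le_iSup₂_of_le σ hσ (by rw [hσx])
  have hval : senderValue p uS uM uR r 0 = x := le_antisymm (hle.trans hcav) hge
  exact ⟨⟨σ, hσ, by rw [hσx, hval]⟩, le_antisymm hle (hcav.trans hge), x, hx, hval⟩
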